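/- Let $\gamma\in[0,1]$. In the IID $\gamma$-prophet inequality, an instance consists of a size $n\ge 1$ and a probability distribution $F$ on $[0,\infty)$ with finite expectation, $F\neq\delta_0$; the values $X_1,\dots,X_n$ are independent with distribution $F$. An algorithm knows $n$ and $F$, observes $X_1,X_2,\dots$ one after the other, and decides after each observation whether to stop; its decision may depend on everything observed so far and on independent random numbers of its own. If it stops at step $\tau\le n$, its reward is $\max\{X_\tau,\gamma X_{\tau-1},\dots,\gamma X_1\}$, and if it never stops ($\tau=n+1$), its reward is $\gamma\max_{i\le n}X_i$. Let $\mathbb{E}[\mathsf{ALG}^\gamma(F,n)]$ be its expected reward. The competitive ratio is \[ \mathsf{CR}^\gamma(\mathsf{ALG})=\inf_{(F,n)}\frac{\mathbb{E}[\mathsf{ALG}^\gamma(F,n)]}{\mathbb{E}[\max_{i\le n}X_i]}. \] A single-threshold algorithm fixes, for each instance $(F,n)$, a threshold $\theta\in[0,\infty]$ and a number $q\in[0,1]$; it stops at the first $X_i>\theta$, and a value $X_i=\theta$ is accepted with probability $q$, independently in each step. \textbf{Theorem.} For every $\gamma\in[0,1]$, every algorithm $\mathsf{ALG}$ satisfies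 \[ \mathsf{CR}^\gamma(\mathsf{ALG})\le U(\gamma)=1-(1-\gamma)\frac{e^2\log(3-\gamma)-(2-\gamma)}{2(2e^2-1)-(3e^2-1)\gamma}. \] The function $U$ is (strictly) increasing on $[0,1]$, $U(0)=\frac{4-\log 3}{2(2-1/e^2)}\approx 0.778$ (that is, $|U(0)-0.778|<0.0005$), and $U(1)=1$. Furthermore, for every $\gamma\in[0,1]$ the equation \[ 1-(1-\gamma)p=\frac{1-p}{-\log p} \] has a unique solution $p_\gamma\in(0,1]$, where the right-hand side is read as its limit $1$ at $p=1$ (so $p_1=1$, and $p_\gamma<1$ for $\gamma<1$), and there is a single-threshold algorithm $\mathsf{ALG}_\theta$, with $q=0$ whenever $F$ has no atoms, such that \[ \mathsf{CR}^\gamma(\mathsf{ALG}_\theta)\ge 1-(1-\gamma)p_\gamma . \] -/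

import Mathlib

open scoped NNReal ENNReal

noncomputable section

namespace Prophet

/-- An instance of the IID model: `n ≥ 1` values drawn independently from one distribution `F` on
`[0, ∞)` with finite expectation. The distribution concentrated at `0` is left out, because the
ratio to the prophet's value would be `0 / 0`. -/
structure IIDInstance where
  n : ℕ
  n_pos : 0 < n
  F : MeasureTheory.Measure ℝ≥0
  isProb : MeasureTheory.IsProbabilityMeasure F
  integrable : MeasureTheory.Integrable (fun x : ℝ≥0 => (x : ℝ)) F
  mean_pos : 0 < ∫ x : ℝ≥0, (x : ℝ) ∂F

instance instIsProbF (I : IIDInstance) : MeasureTheory.IsProbabilityMeasure I.F := I.isProb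

/-- What an algorithm sees in one step: the value of the item, together with a random number from
`[0, 1]` that it may use to randomize its decisions. -/
abbrev Obs : Type := ℝ≥0 × unitInterval

/-- The values and the random numbers of all steps: independent over the steps, each value drawn
from `F` and each random number uniform on `[0, 1]` and independent of the value. -/
def obsLaw (I : IIDInstance) : MeasureTheory.Measure (Fin I.n → Obs) :=
  MeasureTheory.Measure.pi fun _ => I.F.prod MeasureTheory.volume

/-- An online algorithm, which knows the instance. Steps are numbered from `0`; `accept I k` is the
set of histories of the steps `0, …, k` on which the algorithm, if still running, stops at step
`k`. A deterministic algorithm ignores the random numbers. -/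
structure Algorithm where
  accept : (I : IIDInstance) → (k : ℕ) → Set (Fin (k + 1) → Obs)
  measurableSet_accept : ∀ I k, MeasurableSet (accept I k)

/-- The step at which the algorithm stops: the first step `k < n` whose history is accepted, and
`n` if there is none (no item is selected). -/
def Algorithm.stopTime (A : Algorithm) (I : IIDInstance) (ω : Fin I.n → Obs) : ℕ :=
  sInf ({k : ℕ | ∃ h : k < I.n,
    (fun j : Fin (k + 1) => ω ⟨j, by omega⟩) ∈ A.accept I k} ∪ {I.n})

/-- The reward for stopping at step `t` on the values `x`: the largest of `x t` and all `γ * x i`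
with `i < t`. For `t = n` this is `γ` times the largest value. -/
def reward (γ : ℝ≥0) {n : ℕ} (x : Fin n → ℝ≥0) (t : ℕ) : ℝ≥0 :=
  Finset.univ.sup fun i : Fin n =>
    if (i : ℕ) < t then γ * x i else if (i : ℕ) = t then x i else 0

/-- The expected reward of the algorithm on an instance in the `γ`-prophet inequality. -/
def expectedReward (γ : ℝ≥0) (A : Algorithm) (I : IIDInstance) : ℝ :=
  ∫ ω, (reward γ (fun i => (ω i).1) (A.stopTime I ω) : ℝ) ∂(obsLaw I)

/-- The expected maximum of the values. -/
def expectedMax (I : IIDInstance) : ℝ :=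
  ∫ x : Fin I.n → ℝ≥0, ((Finset.univ.sup x : ℝ≥0) : ℝ)
    ∂(MeasureTheory.Measure.pi fun _ => I.F)

/-- The competitive ratio in the IID `γ`-prophet inequality: the infimum over all instances, of all
sizes, of a family of nonnegative numbers. -/
def competitiveRatio (γ : ℝ≥0) (A : Algorithm) : ℝ :=
  ⨅ I : IIDInstance, expectedReward γ A I / expectedMax I

/-- The single-threshold algorithm with threshold `θ I ∈ [0, ∞]`: it stops at the first value
greater than `θ I`; a value equal to `θ I` is accepted with probability `q I`, independently in
each step. -/
def singleThreshold (θ : IIDInstance → ℝ≥0∞) (q : IIDInstance → unitInterval) : Algorithm where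
  accept I k := {h | θ I < ((h (Fin.last k)).1 : ℝ≥0∞) ∨
    (((h (Fin.last k)).1 : ℝ≥0∞) = θ I ∧ (h (Fin.last k)).2 < q I)}
  measurableSet_accept I k := by
    have h1 : Measurable fun h : Fin (k + 1) → Obs => ((h (Fin.last k)).1 : ℝ≥0∞) :=
      (measurable_fst.comp (measurable_pi_apply _)).coe_nnreal_ennreal
    have h2 : Measurable fun h : Fin (k + 1) → Obs => (h (Fin.last k)).2 :=
      measurable_snd.comp (measurable_pi_apply _)
    have h3 : MeasurableSet {h : Fin (k + 1) → Obs | (h (Fin.last k)).2 < q I} :=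
      h2 (measurableSet_Iio (a := q I))
    exact (measurableSet_lt measurable_const h1).union
      ((measurableSet_eq_fun h1 measurable_const).inter h3)

/-- The upper bound on the competitive ratio. -/
def U (γ : ℝ) : ℝ :=
  1 - (1 - γ) * (Real.exp 1 ^ 2 * Real.log (3 - γ) - (2 - γ)) /
    (2 * (2 * Real.exp 1 ^ 2 - 1) - (3 * Real.exp 1 ^ 2 - 1) * γ)

/-- The function `(1 - p) / (- log p)` on `(0, 1]`, with its continuous extension at `p = 1`. -/
def logRatio (p : ℝ) : ℝ := if p = 1 then 1 else (1 - p) / (-Real.log p)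

/-- `p` is a solution in `(0, 1]` of `1 - (1 - γ) p = (1 - p) / (- log p)`. -/
def IsSolution (γ p : ℝ) : Prop :=
  0 < p ∧ p ≤ 1 ∧ 1 - (1 - γ) * p = logRatio p

end Prophet

end

open scoped NNReal ENNReal

noncomputable section

namespace Prophet

open MeasureTheory

/-! ### The function `U`: monotonicity and values -/

section Bound

lemma seven_lt_exp_two : (7 : ℝ) < Real.exp 1 ^ 2 := by
  nlinarith [Real.exp_one_gt_d9]

lemma half_lt_log_three_sub {γ : ℝ} (h : γ ≤ 1) : (1 / 2 : ℝ) < Real.log (3 - γ) :=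
  lt_of_lt_of_le (by linarith [Real.log_two_gt_d9])
    (Real.log_le_log (by norm_num) (by linarith : (2 : ℝ) ≤ 3 - γ))

lemma U_numerator_strictAntiOn :
    StrictAntiOn (fun γ : ℝ => Real.exp 1 ^ 2 * Real.log (3 - γ) - (2 - γ)) (Set.Icc 0 1) := by
  intro x hx y hy hxy
  have hx1 := hx.1
  have hy2 := hy.2
  have he := seven_lt_exp_two
  -- The tangent bound replaces the derivative: the logarithm drops by at least `(y - x) / 3`, and
  -- `e² > 7` makes this outweigh the gain `y - x` of the linear term.
  have hlog : Real.log ((3 - y) / (3 - x)) ≤ (3 - y) / (3 - x) - 1 :=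
    Real.log_le_sub_one_of_pos (div_pos (by linarith) (by linarith))
  rw [Real.log_div (by linarith) (by linarith)] at hlog
  have h3 : (3 - y) / (3 - x) - 1 ≤ -((y - x) / 3) := by
    rw [div_sub_one (by linarith), div_le_iff₀ (by linarith)]
    nlinarith
  simp only
  nlinarith

lemma U_denominator_pos {γ : ℝ} (h : γ ≤ 1) :
    0 < 2 * (2 * Real.exp 1 ^ 2 - 1) - (3 * Real.exp 1 ^ 2 - 1) * γ := by
  nlinarith [seven_lt_exp_two]

lemma U_numerator_pos {γ : ℝ} (h0 : 0 ≤ γ) (h : γ ≤ 1) :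
    0 < Real.exp 1 ^ 2 * Real.log (3 - γ) - (2 - γ) := by
  nlinarith [seven_lt_exp_two, half_lt_log_three_sub h]

/-- The subtracted term is a product of two positive decreasing factors on `[0, 1)`: the numerator,
and `(1 - γ)` over the denominator. The latter decreases because cross-multiplication leaves `(e² -
1)(y - x) > 0`. -/
lemma U_strictMonoOn : StrictMonoOn U (Set.Icc 0 1) := by
  intro x hx y hy hxy
  have hN := U_numerator_strictAntiOn hx hy hxy
  have hNx := U_numerator_pos hx.1 hx.2
  have hNy := U_numerator_pos hy.1 hy.2
  have hDx := U_denominator_pos hx.2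
  have hDy := U_denominator_pos hy.2
  have he := seven_lt_exp_two
  unfold U
  simp only at hN
  have key : (1 - y) / (2 * (2 * Real.exp 1 ^ 2 - 1) - (3 * Real.exp 1 ^ 2 - 1) * y)
      < (1 - x) / (2 * (2 * Real.exp 1 ^ 2 - 1) - (3 * Real.exp 1 ^ 2 - 1) * x) := by
    rw [div_lt_div_iff₀ hDy hDx]
    nlinarith
  have hpos : 0 ≤ (1 - y) / (2 * (2 * Real.exp 1 ^ 2 - 1) - (3 * Real.exp 1 ^ 2 - 1) * y) :=
    div_nonneg (by linarith [hy.2]) hDy.le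
  have := mul_lt_mul'' key hN hpos hNy.le
  rw [div_mul_eq_mul_div, div_mul_eq_mul_div] at this
  linarith

lemma U_zero : U 0 = (4 - Real.log 3) / (2 * (2 - 1 / Real.exp 1 ^ 2)) := by
  have he := seven_lt_exp_two
  unfold U
  generalize Real.exp 1 ^ 2 = E at he ⊢
  have h1 : 2 * E - 1 ≠ 0 := by linarith
  have h2 : (2 - 1 / E) = (2 * E - 1) / E := by field_simp
  rw [h2, eq_div_iff (by positivity), sub_mul]
  simp only [sub_zero, mul_zero, one_mul]
  field_simp
  ring

lemma U_one : U 1 = 1 := by simp [U]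

lemma abs_U_zero_sub_lt : |U 0 - 0.778| < 0.0005 := by
  have h1 := Real.exp_one_gt_d9
  have h2 := Real.exp_one_lt_d9
  have e1 : (7.389 : ℝ) < Real.exp 1 ^ 2 := by nlinarith
  have e2 : Real.exp 1 ^ 2 < (7.3891 : ℝ) := by nlinarith
  have i1 : (1 / Real.exp 1 ^ 2 : ℝ) < 0.1354 := by
    rw [div_lt_iff₀ (by linarith)]; nlinarith
  have i2 : (0.1353 : ℝ) < 1 / Real.exp 1 ^ 2 := by
    rw [lt_div_iff₀ (by linarith)]; nlinarith
  have l1 : (1.098 : ℝ) < Real.log 3 := by linarith [Real.log_three_gt_d9]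
  have l2 : Real.log 3 < (1.099 : ℝ) := by linarith [Real.log_three_lt_d9]
  rw [U_zero, abs_lt]
  constructor
  · rw [lt_sub_iff_add_lt, lt_div_iff₀ (by linarith)]
    nlinarith
  · rw [sub_lt_iff_lt_add, div_lt_iff₀ (by linarith)]
    nlinarith

end Bound

/-! ### Existence and uniqueness of `p_γ` -/

section Solution

lemma logRatio_of_ne {p : ℝ} (h : p ≠ 1) : logRatio p = (1 - p) / (-Real.log p) := if_neg h

lemma logRatio_one : logRatio 1 = 1 := if_pos rfl

lemma logRatio_lt_one {p : ℝ} (h0 : 0 < p) (h1 : p < 1) : logRatio p < 1 := by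
  have := Real.log_lt_sub_one_of_pos h0 h1.ne
  rw [logRatio_of_ne h1.ne, div_lt_one (by linarith)]
  linarith

lemma le_logRatio {p : ℝ} (h0 : 0 < p) (h1 : p < 1) : p ≤ logRatio p := by
  have hl := Real.log_neg h0 h1
  have := Real.one_sub_inv_le_log_of_pos h0
  rw [logRatio_of_ne h1.ne, le_div_iff₀ (by linarith)]
  have h2 : p * (1 - p⁻¹) ≤ p * Real.log p := mul_le_mul_of_nonneg_left this h0.le
  rw [mul_sub, mul_inv_cancel₀ h0.ne'] at h2
  linarith

/-- The reciprocal `-log p / (1 - p)` is the slope of the chord of `log` from `p` to `1`, which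
decreases by strict concavity. -/
lemma logRatio_strictMonoOn : StrictMonoOn logRatio (Set.Ioc 0 1) := by
  intro x hx y hy hxy
  rcases hy.2.eq_or_lt with rfl | hy1
  · rw [logRatio_one]
    exact logRatio_lt_one hx.1 hxy
  have hx1 := hxy.trans hy1
  have hs := strictConcaveOn_log_Ioi.slope_anti_adjacent (Set.mem_Ioi.2 hx.1)
    (Set.mem_Ioi.2 (zero_lt_one' ℝ)) hxy hy1
  rw [Real.log_one] at hs
  have lx := Real.log_neg hx.1 hx1
  have ly := Real.log_neg hy.1 hy1
  rw [div_lt_div_iff₀ (by linarith) (by linarith)] at hs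
  rw [logRatio_of_ne hx1.ne, logRatio_of_ne hy1.ne, div_lt_div_iff₀ (by linarith) (by linarith)]
  nlinarith

lemma IsSolution.unique {γ p p' : ℝ} (hγ : γ ≤ 1) (h : IsSolution γ p) (h' : IsSolution γ p') :
    p = p' := by
  have key : ∀ {x y : ℝ}, IsSolution γ x → IsSolution γ y → ¬ x < y := by
    intro x y hx hy hxy
    have := logRatio_strictMonoOn ⟨hx.1, hx.2.1⟩ ⟨hy.1, hy.2.1⟩ hxy
    rw [← hx.2.2, ← hy.2.2] at this
    nlinarith
  exact le_antisymm (not_lt.1 (key h' h)) (not_lt.1 (key h h'))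

lemma exists_isSolution {γ : ℝ} (h0 : 0 ≤ γ) (h1 : γ ≤ 1) : ∃ p, IsSolution γ p := by
  rcases h1.eq_or_lt with rfl | h1
  · exact ⟨1, one_pos, le_rfl, by simp [logRatio_one]⟩
  have he : Real.exp (-2) < 1 / 7 := by
    rw [Real.exp_neg, show (2 : ℝ) = (2 : ℕ) * 1 by norm_num, Real.exp_nat_mul, ← one_div]
    exact one_div_lt_one_div_of_lt (by norm_num) seven_lt_exp_two
  have hpos := Real.exp_pos (-2)
  have hb : 1 / 2 ≤ 1 / (2 - γ) := one_div_le_one_div_of_le (by linarith) (by linarith)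
  have hb1 : 1 / (2 - γ) < 1 := by rw [div_lt_one (by linarith)]; linarith
  have hcont : ContinuousOn (fun p : ℝ => (1 - p) / (-Real.log p) - (1 - (1 - γ) * p))
      (Set.Icc (Real.exp (-2)) (1 / (2 - γ))) := by
    refine ContinuousOn.sub (ContinuousOn.div (by fun_prop) ?_ ?_) (by fun_prop)
    · exact (Real.continuousOn_log.mono fun x hx => (hpos.trans_le hx.1).ne').neg
    · intro x hx
      exact (neg_pos.2 (Real.log_neg (hpos.trans_le hx.1) (hx.2.trans_lt hb1))).ne'
  have hle := le_logRatio (p := 1 / (2 - γ)) (by linarith) hb1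
  rw [logRatio_of_ne hb1.ne] at hle
  -- At `e⁻²` the quotient is below `1/2`, while `1 - (1-γ)p` exceeds `6/7`. At `1/(2-γ)` the
  -- expression `1 - (1-γ)p` equals `p` itself, and `le_logRatio` applies.
  obtain ⟨p, hp, hfp⟩ := intermediate_value_Icc (by linarith) hcont
    (show (0 : ℝ) ∈ Set.Icc _ _ from by
      constructor
      · simp only [Real.log_exp]
        nlinarith
      · have : 1 - (1 - γ) * (1 / (2 - γ)) = 1 / (2 - γ) := by
          have : 2 - γ ≠ 0 := by linarith
          field_simp
          ring
        simp only [this]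
        linarith)
  have hp1 := hp.2.trans_lt hb1
  refine ⟨p, hpos.trans_le hp.1, hp1.le, ?_⟩
  rw [logRatio_of_ne hp1.ne]
  simp only at hfp
  linarith

lemma IsSolution.lt_one {γ p : ℝ} (h1 : γ < 1) (h : IsSolution γ p) : p < 1 := by
  refine h.2.1.lt_of_ne ?_
  rintro rfl
  have := h.2.2
  rw [logRatio_one] at this
  linarith

end Solution

/-! ### Stopping times, rewards and integrability -/

section Model

/-- The history of the steps `0, …, k`. -/
def history {n : ℕ} (ω : Fin n → Obs) {k : ℕ} (hk : k < n) : Fin (k + 1) → Obs :=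
  fun j => ω ⟨j, by omega⟩

lemma measurable_history {n k : ℕ} (hk : k < n) :
    Measurable fun ω : Fin n → Obs => history ω hk :=
  measurable_pi_lambda _ fun _ => measurable_pi_apply _

namespace Algorithm

variable (A : Algorithm) (I : IIDInstance)

lemma stopTime_le (ω : Fin I.n → Obs) : A.stopTime I ω ≤ I.n :=
  Nat.sInf_le (Or.inr rfl)

lemma history_mem_of_stopTime_lt {ω : Fin I.n → Obs} (h : A.stopTime I ω < I.n) :
    history ω h ∈ A.accept I (A.stopTime I ω) := by
  have hmem : A.stopTime I ω ∈ ({k : ℕ | ∃ h : k < I.n,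
      (fun j : Fin (k + 1) => ω ⟨j, by omega⟩) ∈ A.accept I k} ∪ {I.n}) :=
    Nat.sInf_mem ⟨I.n, Or.inr rfl⟩
  rcases hmem with ⟨_, h'⟩ | h'
  · exact h'
  · exact absurd h' h.ne

lemma le_stopTime_iff {ω : Fin I.n → Obs} {k : ℕ} (hk : k ≤ I.n) :
    k ≤ A.stopTime I ω ↔ ∀ j (hj : j < I.n), j < k → history ω hj ∉ A.accept I j := by
  constructor
  · intro h j hj hjk hmem
    have : A.stopTime I ω ≤ j := Nat.sInf_le (Or.inl ⟨hj, hmem⟩)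
    omega
  · intro h
    by_contra hlt
    have hlt' : A.stopTime I ω < I.n := by omega
    exact h _ hlt' (by omega) (A.history_mem_of_stopTime_lt I hlt')

lemma measurable_stopTime : Measurable (A.stopTime I) := by
  refine measurable_of_Ici fun k => ?_
  rcases le_or_gt k I.n with hk | hk
  · have : A.stopTime I ⁻¹' Set.Ici k = ⋂ j : ℕ, ⋂ hj : j < I.n, ⋂ _ : j < k,
        (fun ω => history ω hj) ⁻¹' (A.accept I j)ᶜ := by
      ext ω
      simp only [Set.mem_preimage, Set.mem_Ici, A.le_stopTime_iff I hk, Set.mem_iInter,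
        Set.mem_compl_iff]
    rw [this]
    exact MeasurableSet.iInter fun j => MeasurableSet.iInter fun hj => MeasurableSet.iInter
      fun _ => measurable_history hj (A.measurableSet_accept I j).compl
  · convert MeasurableSet.empty
    ext ω
    have := A.stopTime_le I ω
    simp only [Set.mem_preimage, Set.mem_Ici, Set.mem_empty_iff_false, iff_false]
    omega

end Algorithm

/-- The values contained in a sequence of observations. -/
def values {n : ℕ} (ω : Fin n → Obs) : Fin n → ℝ≥0 := fun i => (ω i).1

lemma measurable_values {n : ℕ} : Measurable (values (n := n)) :=
  measurable_pi_lambda _ fun _ => measurable_fst.comp (measurable_pi_apply _)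

lemma measurable_finset_sup_univ {α : Type*} [MeasurableSpace α] {n : ℕ} {f : Fin n → α → ℝ≥0}
    (hf : ∀ i, Measurable (f i)) : Measurable fun a => Finset.univ.sup fun i => f i a := by
  suffices h : ∀ s : Finset (Fin n), Measurable fun a => s.sup fun i => f i a from h _
  intro s
  induction s using Finset.induction_on with
  | empty => simp
  | insert i s _ ih =>
    simp only [Finset.sup_insert]
    exact (hf i).sup ih

lemma measurable_reward (γ : ℝ≥0) {n : ℕ} (t : ℕ) :
    Measurable fun x : Fin n → ℝ≥0 => reward γ x t := by
  unfold reward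
  refine measurable_finset_sup_univ fun i => ?_
  split_ifs
  · exact measurable_const.mul (measurable_pi_apply i)
  · exact measurable_pi_apply i
  · exact measurable_const

lemma measurable_reward_stopTime (γ : ℝ≥0) (A : Algorithm) (I : IIDInstance) :
    Measurable fun ω => reward γ (values ω) (A.stopTime I ω) := by
  have : Measurable fun p : (Fin I.n → ℝ≥0) × ℕ => reward γ p.1 p.2 :=
    measurable_from_prod_countable_left fun t => measurable_reward γ t
  exact this.comp (measurable_values.prodMk (A.measurable_stopTime I))

lemma reward_le_sup {γ : ℝ≥0} (hγ : γ ≤ 1) {n : ℕ} (x : Fin n → ℝ≥0) (t : ℕ) :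
    reward γ x t ≤ Finset.univ.sup x := by
  refine Finset.sup_le fun i hi => le_trans ?_ (Finset.le_sup hi)
  split_ifs
  · exact mul_le_of_le_one_left' hγ
  · exact le_rfl
  · exact zero_le

lemma le_reward (γ : ℝ≥0) {n : ℕ} (x : Fin n → ℝ≥0) (i : Fin n) : x i ≤ reward γ x i := by
  have := Finset.le_sup (f := fun j : Fin n =>
    if (j : ℕ) < i then γ * x j else if (j : ℕ) = i then x j else 0) (Finset.mem_univ i)
  simpa [reward] using this

lemma reward_last (γ : ℝ≥0) {n : ℕ} (x : Fin n → ℝ≥0) :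
    reward γ x n = γ * Finset.univ.sup x := by
  unfold reward
  rw [NNReal.mul_finset_sup]
  exact Finset.sup_congr rfl fun i _ => by simp

instance (I : IIDInstance) : IsProbabilityMeasure (obsLaw I) := by
  unfold obsLaw; infer_instance

variable (I : IIDInstance)

lemma measurePreserving_eval_obsLaw (i : Fin I.n) :
    MeasurePreserving (fun ω : Fin I.n → Obs => ω i) (obsLaw I) (I.F.prod volume) :=
  measurePreserving_eval (fun _ : Fin I.n => I.F.prod (volume : Measure unitInterval)) i

lemma measurePreserving_values :
    MeasurePreserving (values (n := I.n)) (obsLaw I) (Measure.pi fun _ => I.F) :=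
  measurePreserving_pi (fun _ : Fin I.n => I.F.prod (volume : Measure unitInterval))
    (fun _ => I.F) fun _ => measurePreserving_fst

lemma expectedMax_eq :
    expectedMax I = ∫ ω, ((Finset.univ.sup (values ω) : ℝ≥0) : ℝ) ∂(obsLaw I) := by
  rw [expectedMax, ← (measurePreserving_values I).map_eq, integral_map]
  · exact measurable_values.aemeasurable
  · exact (measurable_finset_sup_univ fun i => measurable_pi_apply i).coe_nnreal_real
      |>.aestronglyMeasurable

lemma integrable_value (i : Fin I.n) :
    Integrable (fun ω => ((values ω i : ℝ≥0) : ℝ)) (obsLaw I) :=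
  ((measurePreserving_fst.integrable_comp_of_integrable I.integrable) : Integrable
    (fun o : Obs => (o.1 : ℝ)) (I.F.prod volume)) |>
    (measurePreserving_eval_obsLaw I i).integrable_comp_of_integrable

lemma integrable_sup_values :
    Integrable (fun ω => ((Finset.univ.sup (values ω) : ℝ≥0) : ℝ)) (obsLaw I) := by
  refine (integrable_finsetSum Finset.univ fun i _ => integrable_value I i).mono'
    ((measurable_finset_sup_univ fun i => measurable_pi_apply i).comp
      measurable_values).coe_nnreal_real.aestronglyMeasurable (ae_of_all _ fun ω => ?_)
  rw [Real.norm_of_nonneg NNReal.zero_le_coe]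
  have : Finset.univ.sup (values ω) ≤ ∑ i, values ω i :=
    Finset.sup_le fun i hi => Finset.single_le_sum (f := values ω) (fun _ _ => zero_le) hi
  exact_mod_cast this

lemma integrable_reward {γ : ℝ≥0} (hγ : γ ≤ 1) (A : Algorithm) :
    Integrable (fun ω => (reward γ (values ω) (A.stopTime I ω) : ℝ)) (obsLaw I) := by
  refine (integrable_sup_values I).mono'
    (measurable_reward_stopTime γ A I).coe_nnreal_real.aestronglyMeasurable
    (ae_of_all _ fun ω => ?_)
  rw [Real.norm_of_nonneg NNReal.zero_le_coe]
  exact_mod_cast reward_le_sup hγ _ _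

lemma expectedMax_pos : 0 < expectedMax I := by
  refine I.mean_pos.trans_le ?_
  set i : Fin I.n := ⟨0, I.n_pos⟩
  have h1 : ∫ x : ℝ≥0, (x : ℝ) ∂I.F = ∫ ω, ((values ω i : ℝ≥0) : ℝ) ∂(obsLaw I) := by
    have hp : MeasurePreserving (fun ω : Fin I.n → Obs => values ω i) (obsLaw I) I.F :=
      measurePreserving_fst.comp (measurePreserving_eval_obsLaw I i)
    rw [← hp.map_eq, integral_map hp.measurable.aemeasurable]
    exact measurable_coe_nnreal_real.aestronglyMeasurable
  rw [h1, expectedMax_eq]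
  refine integral_mono (integrable_value I i) (integrable_sup_values I) fun ω => ?_
  exact_mod_cast Finset.le_sup (f := values ω) (Finset.mem_univ i)

lemma expectedReward_nonneg (γ : ℝ≥0) (A : Algorithm) : 0 ≤ expectedReward γ A I :=
  integral_nonneg fun _ => NNReal.zero_le_coe

lemma expectedReward_le_expectedMax {γ : ℝ≥0} (hγ : γ ≤ 1) (A : Algorithm) :
    expectedReward γ A I ≤ expectedMax I := by
  rw [expectedMax_eq]
  exact integral_mono (integrable_reward I hγ A) (integrable_sup_values I) fun ω => by
    exact_mod_cast reward_le_sup hγ _ _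

/-- Nonnegativity of the ratios supplies the lower bound that a real infimum needs. -/
lemma competitiveRatio_le (γ : ℝ≥0) (A : Algorithm) :
    competitiveRatio γ A ≤ expectedReward γ A I / expectedMax I :=
  ciInf_le ⟨0, by
    rintro _ ⟨J, rfl⟩
    exact div_nonneg (expectedReward_nonneg J γ A) (expectedMax_pos J).le⟩ I

end Model

/-! ### Factorization over independent steps -/

section Product

/-- The expected payoff of taking the first accepted item when each step accepts with probability
`q` and the expected payoff of a step is `c`. -/
lemma integral_prod_lt_mul {I : IIDInstance} {a b : Obs → ℝ} (i : Fin I.n) :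
    ∫ ω : Fin I.n → Obs, (∏ j, if j < i then a (ω j) else if j = i then b (ω j) else 1)
      ∂(obsLaw I) = (∫ o, a o ∂(I.F.prod volume)) ^ (i : ℕ) * ∫ o, b o ∂(I.F.prod volume) := by
  have h := integral_fintype_prod_eq_prod (𝕜 := ℝ) (μ := fun _ : Fin I.n =>
    I.F.prod (volume : Measure unitInterval))
    (fun j (o : Obs) => if j < i then a o else if j = i then b o else 1)
  rw [obsLaw]
  refine h.trans ?_
  have h2 : ∀ j : Fin I.n, (∫ o, (if j < i then a o else if j = i then b o else 1)
      ∂(I.F.prod (volume : Measure unitInterval)))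
      = (if j < i then ∫ o, a o ∂(I.F.prod volume) else 1) *
        (if j = i then ∫ o, b o ∂(I.F.prod volume) else 1) := by
    intro j
    split_ifs with h3 h4 h4
    · exact absurd h4 h3.ne
    · simp
    · simp
    · simp
  rw [Finset.prod_congr rfl fun j _ => h2 j, Finset.prod_mul_distrib,
    Finset.prod_ite_eq' Finset.univ i, if_pos (Finset.mem_univ i), Finset.prod_ite, Finset.prod_const_one, mul_one, Finset.prod_const]
  congr 2
  have : Finset.univ.filter (fun j => j < i) = Finset.Iio i := by ext; simp
  rw [this, Fin.card_Iio]

end Product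

/-! ### Pointwise bounds for a threshold rule -/

section Threshold

/-- A single step is accepted: the value exceeds the threshold, or equals it and the random number
is below `q`. -/
def acceptSet (θ : ℝ≥0∞) (q : unitInterval) : Set Obs :=
  {o | θ < (o.1 : ℝ≥0∞) ∨ ((o.1 : ℝ≥0∞) = θ ∧ o.2 < q)}

lemma measurableSet_acceptSet (θ : ℝ≥0∞) (q : unitInterval) : MeasurableSet (acceptSet θ q) := by
  have h1 : Measurable fun o : Obs => (o.1 : ℝ≥0∞) := measurable_fst.coe_nnreal_ennreal
  exact (measurableSet_lt measurable_const h1).union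
    ((measurableSet_eq_fun h1 measurable_const).inter (measurable_snd measurableSet_Iio))

variable {θ : IIDInstance → ℝ≥0∞} {q : IIDInstance → unitInterval} {I : IIDInstance}

lemma history_mem_singleThreshold {ω : Fin I.n → Obs} {k : ℕ} (hk : k < I.n) :
    history ω hk ∈ (singleThreshold θ q).accept I k ↔ ω ⟨k, hk⟩ ∈ acceptSet (θ I) (q I) :=
  Iff.rfl

/-- The indicator of acceptance. -/
def acceptInd (θ : ℝ≥0∞) (q : unitInterval) : Obs → ℝ := (acceptSet θ q).indicator 1

lemma acceptInd_of_mem {θ : ℝ≥0∞} {q : unitInterval} {o : Obs} (h : o ∈ acceptSet θ q) :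
    acceptInd θ q o = 1 := by simp [acceptInd, h]

lemma acceptInd_of_notMem {θ : ℝ≥0∞} {q : unitInterval} {o : Obs} (h : o ∉ acceptSet θ q) :
    acceptInd θ q o = 0 := by simp [acceptInd, h]

lemma acceptInd_nonneg (θ : ℝ≥0∞) (q : unitInterval) (o : Obs) : 0 ≤ acceptInd θ q o :=
  Set.indicator_nonneg (fun _ _ => zero_le_one) o

lemma acceptInd_le_one (θ : ℝ≥0∞) (q : unitInterval) (o : Obs) : acceptInd θ q o ≤ 1 :=
  Set.indicator_le_self' (fun _ _ => zero_le_one) o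

lemma measurable_acceptInd (θ : ℝ≥0∞) (q : unitInterval) : Measurable (acceptInd θ q) :=
  measurable_one.indicator (measurableSet_acceptSet θ q)

/-- The reward of a threshold algorithm is at least the first accepted value, or `γ` times the
maximum if no value is accepted. -/
lemma le_reward_singleThreshold (γ : ℝ≥0) (ω : Fin I.n → Obs) :
    (∑ i, ∏ j, if j < i then 1 - acceptInd (θ I) (q I) (ω j)
        else if j = i then acceptInd (θ I) (q I) (ω j) * (ω j).1 else 1)
      + γ * ((Finset.univ.sup (values ω) : ℝ≥0) * ∏ j, (1 - acceptInd (θ I) (q I) (ω j)))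
      ≤ reward γ (values ω) ((singleThreshold θ q).stopTime I ω) := by
  set τ := (singleThreshold θ q).stopTime I ω with hτ
  have hbefore : ∀ j : Fin I.n, (j : ℕ) < τ → ω j ∉ acceptSet (θ I) (q I) := fun j hj hmem =>
    ((singleThreshold θ q).le_stopTime_iff I (Algorithm.stopTime_le _ I ω)).1 le_rfl j j.2 hj hmem
  rcases (Algorithm.stopTime_le (singleThreshold θ q) I ω).lt_or_eq with hlt | heq
  · have hmem : ω ⟨τ, hlt⟩ ∈ acceptSet (θ I) (q I) :=
      (singleThreshold θ q).history_mem_of_stopTime_lt I hlt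
    have h0 : ∏ j, (1 - acceptInd (θ I) (q I) (ω j)) = 0 :=
      Finset.prod_eq_zero (Finset.mem_univ ⟨τ, hlt⟩) (by rw [acceptInd_of_mem hmem, sub_self])
    rw [h0, mul_zero, mul_zero, add_zero, Finset.sum_eq_single ⟨τ, hlt⟩]
    · have hr : ((ω ⟨τ, hlt⟩).1 : ℝ) ≤ reward γ (values ω) τ := by
        exact_mod_cast le_reward γ (values ω) ⟨τ, hlt⟩
      refine le_trans (le_of_eq ?_) hr
      rw [Finset.prod_eq_single ⟨τ, hlt⟩]
      · simp [acceptInd_of_mem hmem]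
      · intro j _ hj
        split_ifs with h1
        · rw [acceptInd_of_notMem (hbefore j h1), sub_zero]
        · rfl
      · simp
    · intro i _ hi
      rcases lt_or_gt_of_ne hi with h1 | h1
      · refine Finset.prod_eq_zero (Finset.mem_univ i) ?_
        simp [acceptInd_of_notMem (hbefore i h1)]
      · refine Finset.prod_eq_zero (Finset.mem_univ ⟨τ, hlt⟩) ?_
        rw [if_pos h1, acceptInd_of_mem hmem, sub_self]
    · simp
  · change τ = I.n at heq
    have hno : ∀ j, acceptInd (θ I) (q I) (ω j) = 0 := fun j =>
      acceptInd_of_notMem (hbefore j (by omega))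
    rw [heq, reward_last, Finset.sum_eq_zero]
    · simp [hno]
    · intro i _
      exact Finset.prod_eq_zero (Finset.mem_univ i) (by simp [hno])

/-- The maximum in terms of the accepted values. -/
lemma sup_values_le (θ : ℝ≥0) (q : unitInterval) {n : ℕ} (ω : Fin n → Obs) :
    ((Finset.univ.sup (values ω) : ℝ≥0) : ℝ) ≤
      ∑ i, acceptInd θ q (ω i) * ((ω i).1 - θ) + θ * (1 - ∏ j, (1 - acceptInd θ q (ω j)))
      + (Finset.univ.sup (values ω) : ℝ≥0) * ∏ j, (1 - acceptInd θ q (ω j)) := by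
  -- Accepted values are at least `θ` and rejected ones at most `θ`, so the summands are the
  -- positive parts of `X_i - θ`. If something is accepted, the maximum is at most `θ` plus their
  -- sum; otherwise the last term is the maximum itself.
  have hterm : ∀ i, 0 ≤ acceptInd θ q (ω i) * ((ω i).1 - θ) := by
    intro i
    by_cases h : ω i ∈ acceptSet θ q
    · rw [acceptInd_of_mem h, one_mul, sub_nonneg]
      rcases h with h | h
      · exact_mod_cast (ENNReal.coe_lt_coe.1 h).le
      · exact_mod_cast (ENNReal.coe_inj.1 h.1).ge
    · rw [acceptInd_of_notMem h, zero_mul]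
  by_cases hex : ∃ i, ω i ∈ acceptSet θ q
  · obtain ⟨i, hi⟩ := hex
    have h0 : ∏ j, (1 - acceptInd θ q (ω j)) = 0 :=
      Finset.prod_eq_zero (Finset.mem_univ i) (by rw [acceptInd_of_mem hi, sub_self])
    rw [h0, mul_zero, add_zero, sub_zero, mul_one]
    obtain ⟨k, -, hk⟩ := Finset.exists_mem_eq_sup Finset.univ ⟨i, Finset.mem_univ i⟩ (values ω)
    rw [hk]
    have hs := Finset.single_le_sum (f := fun i => acceptInd θ q (ω i) * (((ω i).1 : ℝ) - θ))
      (fun i _ => hterm i) (Finset.mem_univ k)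
    by_cases hka : ω k ∈ acceptSet θ q
    · rw [acceptInd_of_mem hka] at hs
      change ((ω k).1 : ℝ) ≤ _
      linarith
    · have : (ω k).1 ≤ θ := by
        by_contra hlt
        exact hka (Or.inl (ENNReal.coe_lt_coe.2 (not_le.1 hlt)))
      have h2 : ((ω k).1 : ℝ) ≤ θ := by exact_mod_cast this
      have h3 := Finset.sum_nonneg fun i (_ : i ∈ Finset.univ) => hterm i
      change ((ω k).1 : ℝ) ≤ _
      linarith
  · push Not at hex
    have hno : ∀ i, acceptInd θ q (ω i) = 0 := fun i => acceptInd_of_notMem (hex i)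
    simp [hno]

lemma sup_values_mul_prod_le (θ : ℝ≥0) (q : unitInterval) {n : ℕ} (ω : Fin n → Obs) :
    (Finset.univ.sup (values ω) : ℝ≥0) * ∏ j, (1 - acceptInd θ q (ω j))
      ≤ θ * ∏ j, (1 - acceptInd θ q (ω j)) := by
  by_cases hex : ∃ i, ω i ∈ acceptSet θ q
  · obtain ⟨i, hi⟩ := hex
    have h0 : ∏ j, (1 - acceptInd θ q (ω j)) = 0 :=
      Finset.prod_eq_zero (Finset.mem_univ i) (by rw [acceptInd_of_mem hi, sub_self])
    simp [h0]
  · push Not at hex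
    have : Finset.univ.sup (values ω) ≤ θ := Finset.sup_le fun i _ => by
      by_contra hlt
      exact hex i (Or.inl (ENNReal.coe_lt_coe.2 (not_le.1 hlt)))
    have hno : ∀ i, acceptInd θ q (ω i) = 0 := fun i => acceptInd_of_notMem (hex i)
    simpa [hno] using this

end Threshold

/-! ### Randomized quantiles -/

section Quantile

lemma exists_quantile (F : Measure ℝ≥0) [IsProbabilityMeasure F] {c : ℝ≥0∞} (h0 : 0 < c)
    (h1 : c ≤ 1) : ∃ θ : ℝ≥0, F (Set.Ioi θ) ≤ c ∧ c ≤ F (Set.Ici θ) := by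
  set S : Set ℝ≥0 := {t | F (Set.Ioi t) ≤ c}
  -- The tails beyond the natural numbers decrease to the measure of the empty set, hence fall below
  -- `c > 0`.
  have hne : S.Nonempty := by
    by_contra hemp
    have hall : ∀ t, c < F (Set.Ioi t) := fun t => by
      by_contra h
      exact hemp ⟨t, not_lt.1 h⟩
    have hanti : Antitone fun n : ℕ => Set.Ioi (n : ℝ≥0) := fun a b hab =>
      Set.Ioi_subset_Ioi (by exact_mod_cast hab)
    have := hanti.measure_iInter (μ := F) (fun i => measurableSet_Ioi.nullMeasurableSet)
      ⟨0, measure_ne_top _ _⟩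
    have hempty : ⋂ n : ℕ, Set.Ioi (n : ℝ≥0) = ∅ := by
      ext x
      obtain ⟨n, hn⟩ := exists_nat_gt x
      simp only [Set.mem_iInter, Set.mem_Ioi, Set.mem_empty_iff_false, iff_false]
      exact fun h => (h n).not_gt hn
    rw [hempty, measure_empty] at this
    have : c ≤ 0 := this ▸ le_iInf fun n => (hall n).le
    exact h0.not_ge this
  refine ⟨sInf S, ?_, ?_⟩
  · obtain ⟨u, hu, hlt, hlim⟩ := exists_seq_strictAnti_tendsto (sInf S)
    have hun : Set.Ioi (sInf S) = ⋃ n, Set.Ioi (u n) := by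
      ext x
      simp only [Set.mem_Ioi, Set.mem_iUnion]
      exact ⟨fun h => (hlim.eventually (gt_mem_nhds h)).exists, fun ⟨n, hn⟩ => (hlt n).trans hn⟩
    have hmono : Monotone fun n => Set.Ioi (u n) := fun a b hab =>
      Set.Ioi_subset_Ioi (hu.antitone hab)
    rw [hun, hmono.measure_iUnion]
    refine iSup_le fun n => ?_
    obtain ⟨s, hs, hsu⟩ := exists_lt_of_csInf_lt hne (hlt n)
    exact (measure_mono (Set.Ioi_subset_Ioi hsu.le)).trans hs
  · rcases eq_zero_or_pos (sInf S) with hz | hpos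
    · rw [hz]
      have : Set.Ici (0 : ℝ≥0) = Set.univ := Set.eq_univ_of_forall fun x => Set.mem_Ici.2 zero_le
      rw [this, measure_univ]
      exact h1
    · obtain ⟨u, hu, hlt, hlim⟩ := exists_seq_strictMono_tendsto' hpos
      have hin : Set.Ici (sInf S) = ⋂ n, Set.Ioi (u n) := by
        ext x
        simp only [Set.mem_Ici, Set.mem_iInter, Set.mem_Ioi]
        exact ⟨fun h n => (hlt n).2.trans_le h, fun h => le_of_tendsto' hlim fun n => (h n).le⟩
      have hanti : Antitone fun n => Set.Ioi (u n) := fun a b hab =>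
        Set.Ioi_subset_Ioi (hu.monotone hab)
      rw [hin, hanti.measure_iInter (fun i => measurableSet_Ioi.nullMeasurableSet)
        ⟨0, measure_ne_top _ _⟩]
      refine le_iInf fun n => ?_
      by_contra hcon
      exact (csInf_le' (show u n ∈ S from (not_le.1 hcon).le)).not_gt (hlt n).2

lemma exists_randomized_quantile (F : Measure ℝ≥0) [IsProbabilityMeasure F] {c : ℝ} (h0 : 0 < c)
    (h1 : c ≤ 1) : ∃ (θ : ℝ≥0) (q : unitInterval),
      F.real (Set.Ioi θ) + q * F.real {θ} = c ∧ (F {θ} = 0 → q = 0) := by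
  obtain ⟨θ, hl, hu⟩ := exists_quantile F (c := ENNReal.ofReal c) (by simpa) (by simpa)
  have hl' : F.real (Set.Ioi θ) ≤ c := ENNReal.toReal_le_of_le_ofReal h0.le hl
  have hu' : c ≤ F.real (Set.Ici θ) := (ENNReal.ofReal_le_iff_le_toReal (measure_ne_top _ _)).1 hu
  have hsplit : F.real (Set.Ici θ) = F.real (Set.Ioi θ) + F.real {θ} := by
    rw [← measureReal_union (by simp) (measurableSet_singleton θ), Set.Ioi_union_left]
  have hd : 0 ≤ F.real {θ} := measureReal_nonneg
  -- If `θ` is no atom, division by zero gives `q = 0`, as required; then the tail beyond `θ`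
  -- already has mass `c`.
  refine ⟨θ, ⟨(c - F.real (Set.Ioi θ)) / F.real {θ}, div_nonneg (by linarith) hd,
    div_le_one_of_le₀ (by linarith) hd⟩, ?_, ?_⟩
  · rcases hd.eq_or_lt with hz | hpos
    · simp only [← hz, mul_zero]
      linarith
    · simp only
      rw [div_mul_cancel₀ _ hpos.ne']
      ring
  · intro h
    ext
    simp [Measure.real, h]

lemma integral_acceptInd (F : Measure ℝ≥0) [IsProbabilityMeasure F] (θ : ℝ≥0) (q : unitInterval) :
    ∫ o, acceptInd θ q o ∂(F.prod volume) = F.real (Set.Ioi θ) + q * F.real {θ} := by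
  have hset : acceptSet θ q = (Set.Ioi θ ×ˢ Set.univ) ∪ ({θ} ×ˢ Set.Iio q) := by
    ext ⟨x, u⟩
    simp [acceptSet]
  rw [acceptInd, integral_indicator_one (measurableSet_acceptSet _ _), hset, measureReal_union]
  · rw [measureReal_prod_prod, measureReal_prod_prod, probReal_univ, mul_one, mul_comm (q : ℝ)]
    congr 2
    rw [Measure.real, unitInterval.volume_Iio, ENNReal.toReal_ofReal q.2.1]
  · rw [Set.disjoint_left]
    rintro ⟨x, u⟩ ⟨h1, -⟩ ⟨h2, -⟩
    simp only [Set.mem_Ioi, Set.mem_singleton_iff] at h1 h2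
    exact h1.ne' h2
  · exact (measurableSet_singleton θ).prod measurableSet_Iio

end Quantile

/-! ### The guarantee of the single threshold -/

section Guarantee

variable (I : IIDInstance) (θ : ℝ≥0) (q : unitInterval)

lemma integrable_acceptInd : Integrable (acceptInd θ q) (I.F.prod volume) :=
  (integrable_const (1 : ℝ)).mono' (measurable_acceptInd _ _).aestronglyMeasurable
    (ae_of_all _ fun o => by
      rw [Real.norm_of_nonneg (acceptInd_nonneg _ _ _)]; exact acceptInd_le_one _ _ _)

lemma integrable_acceptInd_mul :
    Integrable (fun o : Obs => acceptInd θ q o * (o.1 : ℝ)) (I.F.prod volume) :=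
  (measurePreserving_fst.integrable_comp_of_integrable I.integrable).mono'
    ((measurable_acceptInd _ _).mul measurable_fst.coe_nnreal_real).aestronglyMeasurable
    (ae_of_all _ fun o => by
      rw [Real.norm_of_nonneg (mul_nonneg (acceptInd_nonneg _ _ _) NNReal.zero_le_coe)]
      exact mul_le_of_le_one_left NNReal.zero_le_coe (acceptInd_le_one _ _ _))

lemma prod_one_sub_acceptInd_mem {n : ℕ} (ω : Fin n → Obs) :
    0 ≤ ∏ j, (1 - acceptInd θ q (ω j)) ∧ ∏ j, (1 - acceptInd θ q (ω j)) ≤ 1 :=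
  ⟨Finset.prod_nonneg fun _ _ => sub_nonneg.2 (acceptInd_le_one _ _ _),
    Finset.prod_le_one (fun _ _ => sub_nonneg.2 (acceptInd_le_one _ _ _))
      fun _ _ => sub_le_self _ (acceptInd_nonneg _ _ _)⟩

lemma measurable_prod_one_sub_acceptInd {n : ℕ} :
    Measurable fun ω : Fin n → Obs => ∏ j, (1 - acceptInd θ q (ω j)) :=
  Finset.measurable_prod _ fun j _ =>
    measurable_const.sub ((measurable_acceptInd _ _).comp (measurable_pi_apply j))

lemma integrable_prod_one_sub_acceptInd :
    Integrable (fun ω : Fin I.n → Obs => ∏ j, (1 - acceptInd θ q (ω j))) (obsLaw I) :=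
  (integrable_const (1 : ℝ)).mono' (measurable_prod_one_sub_acceptInd θ q).aestronglyMeasurable
    (ae_of_all _ fun ω => by
      rw [Real.norm_of_nonneg (prod_one_sub_acceptInd_mem θ q ω).1]
      exact (prod_one_sub_acceptInd_mem θ q ω).2)

lemma integrable_sup_mul_prod :
    Integrable (fun ω : Fin I.n → Obs => ((Finset.univ.sup (values ω) : ℝ≥0) : ℝ) *
      ∏ j, (1 - acceptInd θ q (ω j))) (obsLaw I) :=
  (integrable_sup_values I).mono'
    ((integrable_sup_values I).aestronglyMeasurable.mul
      (measurable_prod_one_sub_acceptInd θ q).aestronglyMeasurable)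
    (ae_of_all _ fun ω => by
      rw [Real.norm_of_nonneg (mul_nonneg NNReal.zero_le_coe (prod_one_sub_acceptInd_mem θ q ω).1)]
      exact mul_le_of_le_one_right NNReal.zero_le_coe (prod_one_sub_acceptInd_mem θ q ω).2)

lemma integral_prod_one_sub_acceptInd :
    ∫ ω : Fin I.n → Obs, (∏ j, (1 - acceptInd θ q (ω j))) ∂(obsLaw I)
      = (1 - ∫ o, acceptInd θ q o ∂(I.F.prod volume)) ^ I.n := by
  have h := integral_fintype_prod_eq_pow (ι := Fin I.n) (𝕜 := ℝ)
    (μ := I.F.prod (volume : Measure unitInterval)) (fun o : Obs => 1 - acceptInd θ q o)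
  rw [obsLaw, h, Fintype.card_fin, integral_sub (integrable_const _) (integrable_acceptInd I θ q)]
  simp

lemma integral_comp_eval (i : Fin I.n) {f : Obs → ℝ} (hf : Measurable f) :
    ∫ ω, f (ω i) ∂(obsLaw I) = ∫ o, f o ∂(I.F.prod volume) := by
  have h := measurePreserving_eval_obsLaw I i
  rw [← h.map_eq, integral_map h.measurable.aemeasurable hf.aestronglyMeasurable]

/-- By independence, first acceptance at step `i` contributes (rejection probability)`^i` times the
mean accepted value; summing over `i` gives the geometric sum. -/
lemma expectedReward_singleThreshold_ge {γ : ℝ≥0} (hγ : γ ≤ 1) {Θ : IIDInstance → ℝ≥0∞}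
    {Q : IIDInstance → unitInterval} (hΘ : Θ I = θ) (hQ : Q I = q) :
    (∑ i ∈ Finset.range I.n, (1 - ∫ o, acceptInd θ q o ∂(I.F.prod volume)) ^ i)
        * ∫ o : Obs, acceptInd θ q o * (o.1 : ℝ) ∂(I.F.prod volume)
      + γ * ∫ ω, ((Finset.univ.sup (values ω) : ℝ≥0) : ℝ) * ∏ j, (1 - acceptInd θ q (ω j))
          ∂(obsLaw I)
      ≤ expectedReward γ (singleThreshold Θ Q) I := by
  have hfac : ∀ i : Fin I.n, Integrable (fun ω : Fin I.n → Obs =>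
      ∏ j, if j < i then 1 - acceptInd θ q (ω j)
        else if j = i then acceptInd θ q (ω j) * ((ω j).1 : ℝ) else 1) (obsLaw I) := by
    intro i
    refine Integrable.fintype_prod (f := fun j (o : Obs) => if j < i then 1 - acceptInd θ q o
        else if j = i then acceptInd θ q o * (o.1 : ℝ) else 1) fun j => ?_
    split_ifs
    · exact (integrable_const _).sub (integrable_acceptInd I θ q)
    · exact integrable_acceptInd_mul I θ q
    · exact integrable_const _
  have hle := integral_mono (((integrable_finsetSum Finset.univ fun i _ => hfac i)).add
    ((integrable_sup_mul_prod I θ q).const_mul (γ : ℝ)))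
    (integrable_reward I hγ (singleThreshold Θ Q))
    (fun ω => by
      have h := le_reward_singleThreshold (θ := Θ) (q := Q) γ ω
      rw [hΘ, hQ] at h
      exact h)
  refine le_trans (le_of_eq ?_) hle
  simp only [Pi.add_apply]
  rw [integral_add (integrable_finsetSum Finset.univ fun i _ => hfac i)
    ((integrable_sup_mul_prod I θ q).const_mul (γ : ℝ)), integral_const_mul,
    integral_finsetSum _ fun i _ => hfac i, ← Fin.sum_univ_eq_sum_range, Finset.sum_mul]
  congr 1
  refine Finset.sum_congr rfl fun i _ => ?_
  rw [integral_prod_lt_mul (a := fun o => 1 - acceptInd θ q o)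
    (b := fun o => acceptInd θ q o * (o.1 : ℝ)) i, integral_sub (integrable_const _)
    (integrable_acceptInd I θ q)]
  simp

lemma expectedMax_le :
    expectedMax I ≤ I.n * (∫ o : Obs, acceptInd θ q o * (o.1 : ℝ) ∂(I.F.prod volume)
        - θ * ∫ o, acceptInd θ q o ∂(I.F.prod volume))
      + θ * (1 - (1 - ∫ o, acceptInd θ q o ∂(I.F.prod volume)) ^ I.n)
      + ∫ ω, ((Finset.univ.sup (values ω) : ℝ≥0) : ℝ) * ∏ j, (1 - acceptInd θ q (ω j))
          ∂(obsLaw I) := by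
  have hstep : Integrable (fun o : Obs => acceptInd θ q o * ((o.1 : ℝ) - θ))
      (I.F.prod volume) := by
    simp_rw [mul_sub]
    exact (integrable_acceptInd_mul I θ q).sub ((integrable_acceptInd I θ q).mul_const _)
  have hmeas : Measurable fun o : Obs => acceptInd θ q o * ((o.1 : ℝ) - θ) :=
    (measurable_acceptInd _ _).mul (measurable_fst.coe_nnreal_real.sub measurable_const)
  have hi : ∀ i : Fin I.n, Integrable (fun ω : Fin I.n → Obs =>
      acceptInd θ q (ω i) * (((ω i).1 : ℝ) - θ)) (obsLaw I) := fun i =>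
    (measurePreserving_eval_obsLaw I i).integrable_comp_of_integrable hstep
  have hsum := integrable_finsetSum Finset.univ fun i (_ : i ∈ Finset.univ) => hi i
  have hN : Integrable (fun ω : Fin I.n → Obs =>
      (θ : ℝ) * (1 - ∏ j, (1 - acceptInd θ q (ω j)))) (obsLaw I) :=
    ((integrable_const (1 : ℝ)).sub (integrable_prod_one_sub_acceptInd I θ q)).const_mul _
  rw [expectedMax_eq]
  refine (integral_mono (integrable_sup_values I)
    ((hsum.add hN).add (integrable_sup_mul_prod I θ q)) (sup_values_le θ q)).trans (le_of_eq ?_)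
  simp only [Pi.add_apply]
  have hadd : Integrable (fun ω : Fin I.n → Obs =>
      ∑ i, acceptInd θ q (ω i) * (((ω i).1 : ℝ) - θ)
        + (θ : ℝ) * (1 - ∏ j, (1 - acceptInd θ q (ω j)))) (obsLaw I) := hsum.add hN
  rw [integral_add hadd (integrable_sup_mul_prod I θ q), integral_add hsum hN, integral_const_mul, integral_sub (integrable_const _)
    (integrable_prod_one_sub_acceptInd I θ q), integral_prod_one_sub_acceptInd,
    integral_finsetSum _ fun i _ => hi i]
  congr 2
  · rw [Finset.sum_congr rfl fun i _ => integral_comp_eval I i hmeas, Finset.sum_const,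
      Finset.card_univ, Fintype.card_fin, nsmul_eq_mul]
    congr 1
    simp_rw [mul_sub]
    rw [integral_sub (integrable_acceptInd_mul I θ q) ((integrable_acceptInd I θ q).mul_const _),
      integral_mul_const, mul_comm (θ : ℝ)]
  · simp

lemma integral_sup_mul_prod_le :
    ∫ ω, ((Finset.univ.sup (values ω) : ℝ≥0) : ℝ) * ∏ j, (1 - acceptInd θ q (ω j)) ∂(obsLaw I)
      ≤ θ * (1 - ∫ o, acceptInd θ q o ∂(I.F.prod volume)) ^ I.n := by
  rw [← integral_prod_one_sub_acceptInd, ← integral_const_mul]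
  exact integral_mono (integrable_sup_mul_prod I θ q)
    ((integrable_prod_one_sub_acceptInd I θ q).const_mul _) (sup_values_mul_prod_le θ q)

lemma threshold_mul_le :
    θ * ∫ o, acceptInd θ q o ∂(I.F.prod volume)
      ≤ ∫ o : Obs, acceptInd θ q o * (o.1 : ℝ) ∂(I.F.prod volume) := by
  rw [← integral_const_mul]
  refine integral_mono ((integrable_acceptInd I θ q).const_mul _)
    (integrable_acceptInd_mul I θ q) fun o => ?_
  simp only
  by_cases h : o ∈ acceptSet θ q
  · rw [acceptInd_of_mem h, one_mul, mul_one]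
    rcases h with h | h
    · exact_mod_cast (ENNReal.coe_lt_coe.1 h).le
    · exact_mod_cast (ENNReal.coe_inj.1 h.1).ge
  · rw [acceptInd_of_notMem h, zero_mul, mul_zero]

variable {I θ q}

/-- The guarantee of a threshold that is never exceeded with probability `p`. -/
lemma mul_expectedMax_le_of_isSolution {γ : ℝ≥0} (hγ : γ < 1) {p : ℝ} (hp : IsSolution γ p)
    {Θ : IIDInstance → ℝ≥0∞} {Q : IIDInstance → unitInterval} (hΘ : Θ I = θ) (hQ : Q I = q)
    (hacc : ∫ o, acceptInd θ q o ∂(I.F.prod volume) = 1 - p ^ (1 / (I.n : ℝ))) :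
    (1 - (1 - (γ : ℝ)) * p) * expectedMax I ≤ expectedReward γ (singleThreshold Θ Q) I := by
  have hγ' : (γ : ℝ) < 1 := by exact_mod_cast hγ
  have hp1 := hp.lt_one hγ'
  have hp0 := hp.1
  have hn : (0 : ℝ) < I.n := by exact_mod_cast I.n_pos
  have h1 := expectedReward_singleThreshold_ge I θ q hγ.le hΘ hQ
  have h2 := expectedMax_le I θ q
  have h3 := integral_sup_mul_prod_le I θ q
  have h4 := threshold_mul_le I θ q
  rw [hacc] at h1 h2 h3 h4
  rw [sub_sub_cancel] at h1 h2 h3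
  have hs : (p ^ (1 / (I.n : ℝ))) ^ I.n = p := by
    rw [one_div]
    exact Real.rpow_inv_natCast_pow hp0.le I.n_pos.ne'
  rw [hs] at h2 h3
  have hslt : p ^ (1 / (I.n : ℝ)) < 1 := Real.rpow_lt_one hp0.le hp1 (by positivity)
  have hsge : 1 + Real.log p / I.n ≤ p ^ (1 / (I.n : ℝ)) := by
    rw [Real.rpow_def_of_pos hp0, mul_one_div, add_comm]
    exact Real.add_one_le_exp _
  have hgeom := geom_sum_mul (p ^ (1 / (I.n : ℝ))) I.n
  rw [hs] at hgeom
  set s := p ^ (1 / (I.n : ℝ))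
  set G := ∑ i ∈ Finset.range I.n, s ^ i
  set y := ∫ o : Obs, acceptInd θ q o * (o.1 : ℝ) ∂(I.F.prod volume)
  set Z := ∫ ω, ((Finset.univ.sup (values ω) : ℝ≥0) : ℝ) * ∏ j, (1 - acceptInd θ q (ω j))
    ∂(obsLaw I)
  have hL : 0 < -Real.log p := neg_pos.2 (Real.log_neg hp0 hp1)
  have hK := hp.2.2
  rw [logRatio_of_ne hp1.ne, eq_div_iff hL.ne'] at hK
  set K := 1 - (1 - (γ : ℝ)) * p with hKdef
  have hKpos : 0 ≤ K := by nlinarith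
  have hnc : I.n * (1 - s) ≤ -Real.log p := by
    have := mul_le_mul_of_nonneg_left hsge hn.le
    rw [mul_add, mul_div_cancel₀ _ hn.ne'] at this
    linarith
  -- After multiplication by `1 - s > 0` this is `K n (1-s) ≤ K (-log p) = 1 - p = G (1-s)`, the
  -- only place where the equation for `p` enters the comparison.
  have hG : I.n * K ≤ G := by
    refine le_of_mul_le_mul_right ?_ (sub_pos.2 hslt)
    nlinarith [mul_le_mul_of_nonneg_left hnc hKpos]
  have e1 : K * expectedMax I ≤ K * (I.n * (y - θ * (1 - s)) + θ * (1 - p) + Z) :=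
    mul_le_mul_of_nonneg_left h2 hKpos
  have e2 : 0 ≤ (G - I.n * K) * (y - θ * (1 - s)) :=
    mul_nonneg (sub_nonneg.2 hG) (sub_nonneg.2 h4)
  have e3 : 0 ≤ (1 - (γ : ℝ)) * (1 - p) * (θ * p - Z) :=
    mul_nonneg (mul_nonneg (by linarith) (by linarith)) (sub_nonneg.2 h3)
  -- Splitting off `θ` from accepted values matches the prophet's bound. The leftover coefficients
  -- are `1 - K = (1-γ)p` and `γ - K = -(1-γ)(1-p)`, which combine into a multiple of `θ p - Z`.
  have e4 : G * y = G * (y - θ * (1 - s)) + θ * (1 - p) := by linear_combination (-(θ : ℝ)) * hgeom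
  have e5 : G * y + γ * Z - K * (I.n * (y - θ * (1 - s)) + θ * (1 - p) + Z)
      = (G - I.n * K) * (y - θ * (1 - s)) + (1 - (γ : ℝ)) * (1 - p) * (θ * p - Z) := by
    rw [e4, hKdef]; ring
  linarith

lemma expectedReward_never {Θ : IIDInstance → ℝ≥0∞} {Q : IIDInstance → unitInterval}
    (hΘ : Θ I = ⊤) : expectedReward 1 (singleThreshold Θ Q) I = expectedMax I := by
  rw [expectedMax_eq]
  refine integral_congr_ae (ae_of_all _ fun ω => ?_)
  have hnever : (singleThreshold Θ Q).stopTime I ω = I.n := by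
    refine le_antisymm (Algorithm.stopTime_le _ I ω)
      ((Algorithm.le_stopTime_iff _ I le_rfl).2 fun j hj _ hmem => ?_)
    rw [history_mem_singleThreshold, hΘ] at hmem
    rcases hmem with h | h
    · exact not_top_lt h
    · exact ENNReal.coe_ne_top h.1
  have := reward_last 1 (values ω)
  rw [one_mul] at this
  simp only [hnever]
  exact congrArg _ this

instance : Nonempty IIDInstance :=
  ⟨⟨1, one_pos, Measure.dirac 1, inferInstance, integrable_dirac (by simp), by simp⟩⟩

theorem exists_singleThreshold_ge {γ : ℝ≥0} (hγ : γ ≤ 1) {p : ℝ} (hp : IsSolution γ p) :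
    ∃ (θ : IIDInstance → ℝ≥0∞) (q : IIDInstance → unitInterval),
      (∀ I : IIDInstance, (∀ x : ℝ≥0, I.F {x} = 0) → q I = 0) ∧
      1 - (1 - (γ : ℝ)) * p ≤ competitiveRatio γ (singleThreshold θ q) := by
  rcases hγ.eq_or_lt with rfl | hlt
  -- For `γ = 1`, never stopping collects the full maximum.
  · refine ⟨fun _ => ⊤, fun _ => 0, fun _ _ => rfl, le_ciInf fun I => ?_⟩
    rw [expectedReward_never rfl, div_self (expectedMax_pos I).ne']
    simp
  · have hp1 := hp.lt_one (by exact_mod_cast hlt)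
    have hex : ∀ I : IIDInstance, ∃ (θ : ℝ≥0) (q : unitInterval),
        I.F.real (Set.Ioi θ) + q * I.F.real {θ} = 1 - p ^ (1 / (I.n : ℝ)) ∧
          (I.F {θ} = 0 → q = 0) := by
      intro I
      have hn : (0 : ℝ) < I.n := by exact_mod_cast I.n_pos
      exact exists_randomized_quantile I.F
        (sub_pos.2 (Real.rpow_lt_one hp.1.le hp1 (by positivity)))
        (sub_le_self _ (Real.rpow_nonneg hp.1.le _))
    choose θ q hθ hq using hex
    refine ⟨fun I => θ I, q, fun I hI => hq I (hI _), le_ciInf fun I => ?_⟩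
    rw [le_div_iff₀ (expectedMax_pos I)]
    exact mul_expectedMax_le_of_isSolution hlt hp rfl rfl ((integral_acceptInd _ _ _).trans (hθ I))

end Guarantee

/-! ### Dynamic programming bound for arbitrary algorithms -/

section Potential

variable {I : IIDInstance}

/-- This is Fubini in one coordinate. The inner integral no longer depends on coordinate `i`, so
integrating that coordinate again changes nothing, and both sides have the same iterated integral.
-/
lemma lintegral_obsLaw_update (i : Fin I.n) {f : (Fin I.n → Obs) → ℝ≥0∞} (hf : Measurable f) :
    ∫⁻ ω, f ω ∂(obsLaw I)
      = ∫⁻ ω, ∫⁻ o, f (Function.update ω i o) ∂(I.F.prod volume) ∂(obsLaw I) := by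
  have hg : Measurable fun ω : Fin I.n → Obs =>
      ∫⁻ o, f (Function.update ω i o) ∂(I.F.prod volume) := by
    refine Measurable.lintegral_prod_right' (f := fun z : (Fin I.n → Obs) × Obs =>
      f (Function.update z.1 i z.2)) (hf.comp ?_)
    exact measurable_update'
  have h1 := lmarginal_erase' (μ := fun _ : Fin I.n => I.F.prod (volume : Measure unitInterval))
    f hf (Finset.mem_univ i)
  have h2 := lmarginal_erase' (μ := fun _ : Fin I.n => I.F.prod (volume : Measure unitInterval))
    _ hg (Finset.mem_univ i)
  simp only [Function.update_idem, lintegral_const, measure_univ, mul_one] at h2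
  rw [← h2] at h1
  simp only [lmarginal_univ] at h1
  exact congrFun h1 fun _ => (0, 0)

/-- The largest of the first `k` values. -/
def prefixMax {n : ℕ} (x : Fin n → ℝ≥0) (k : ℕ) : ℝ≥0 :=
  Finset.univ.sup fun i : Fin n => if (i : ℕ) < k then x i else 0

lemma prefixMax_zero {n : ℕ} (x : Fin n → ℝ≥0) : prefixMax x 0 = 0 := by
  simp [prefixMax]

lemma prefixMax_self {n : ℕ} (x : Fin n → ℝ≥0) : prefixMax x n = Finset.univ.sup x :=
  Finset.sup_congr rfl fun i _ => if_pos i.2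

lemma prefixMax_congr {n k : ℕ} {x y : Fin n → ℝ≥0} (h : ∀ i : Fin n, (i : ℕ) < k → x i = y i) :
    prefixMax x k = prefixMax y k :=
  Finset.sup_congr rfl fun i _ => by split_ifs with hi; exacts [h i hi, rfl]

lemma prefixMax_succ {n : ℕ} (x : Fin n → ℝ≥0) {k : ℕ} (hk : k < n) :
    prefixMax x (k + 1) = max (prefixMax x k) (x ⟨k, hk⟩) := by
  apply le_antisymm
  · refine Finset.sup_le fun i hi => ?_
    split_ifs with h
    · rcases (Nat.lt_succ_iff_lt_or_eq.1 h) with h' | h'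
      · refine le_max_of_le_left (le_trans ?_ (Finset.le_sup hi))
        simp [h']
      · refine le_max_of_le_right (le_of_eq ?_)
        congr 1
        exact Fin.ext h'
    · exact zero_le
  · refine max_le (Finset.sup_mono_fun fun i _ => ?_) ?_
    · split_ifs with h1 h2
      · exact le_rfl
      · omega
      · exact zero_le
      · exact le_rfl
    · refine le_trans ?_ (Finset.le_sup (Finset.mem_univ ⟨k, hk⟩))
      simp

lemma measurable_prefixMax {n : ℕ} (k : ℕ) :
    Measurable fun x : Fin n → ℝ≥0 => prefixMax x k := by
  refine measurable_finset_sup_univ fun i => ?_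
  split_ifs
  · exact measurable_pi_apply i
  · exact measurable_const

lemma reward_congr (γ : ℝ≥0) {n t : ℕ} {x y : Fin n → ℝ≥0}
    (h : ∀ i : Fin n, (i : ℕ) ≤ t → x i = y i) : reward γ x t = reward γ y t :=
  Finset.sup_congr rfl fun i _ => by
    split_ifs with h1 h2
    exacts [by rw [h i h1.le], h i h2.le, rfl]

lemma reward_le_max_prefixMax (γ : ℝ≥0) {n : ℕ} (x : Fin n → ℝ≥0) {k : ℕ} (hk : k < n) :
    reward γ x k ≤ max (x ⟨k, hk⟩) (γ * prefixMax x k) := by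
  refine Finset.sup_le fun i hi => ?_
  split_ifs with h1 h2
  · refine le_max_of_le_right (mul_le_mul_right (le_trans ?_ (Finset.le_sup hi)) γ)
    simp [h1]
  · refine le_max_of_le_left (le_of_eq ?_)
    congr 1
    exact Fin.ext h2
  · exact zero_le

lemma Algorithm.le_stopTime_congr (A : Algorithm) {ω ω' : Fin I.n → Obs} {k j : ℕ}
    (h : ∀ i : Fin I.n, (i : ℕ) < k → ω i = ω' i) (hj : j ≤ k) (hn : j ≤ I.n) :
    j ≤ A.stopTime I ω ↔ j ≤ A.stopTime I ω' := by
  rw [A.le_stopTime_iff I hn, A.le_stopTime_iff I hn]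
  refine forall_congr' fun l => forall_congr' fun hl => forall_congr' fun hlj => ?_
  have : history ω hl = history ω' hl := funext fun i => h _ (by have := i.2; simp only; omega)
  rw [this]

lemma Algorithm.stopTime_congr (A : Algorithm) {ω ω' : Fin I.n → Obs} {k : ℕ} (hk : k ≤ I.n)
    (h : ∀ i : Fin I.n, (i : ℕ) < k → ω i = ω' i) (hlt : A.stopTime I ω < k) :
    A.stopTime I ω' = A.stopTime I ω := by
  have h1 := A.le_stopTime_congr h hlt.le (by omega)
  have h2 := A.le_stopTime_congr h (j := A.stopTime I ω + 1) hlt (by omega)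
  have := h1.1 le_rfl
  have : ¬ A.stopTime I ω + 1 ≤ A.stopTime I ω' := fun h3 => by have := h2.2 h3; omega
  omega

/-- The potential before step `k`: the reward if the algorithm has stopped, and otherwise the
value `Φ` of the remaining steps given the largest value so far. -/
def potential (γ : ℝ≥0) (A : Algorithm) (I : IIDInstance) (Φ : ℕ → ℝ≥0 → ℝ≥0∞) (k : ℕ)
    (ω : Fin I.n → Obs) : ℝ≥0∞ :=
  if A.stopTime I ω < k then (reward γ (values ω) (A.stopTime I ω) : ℝ≥0∞)
  else Φ (I.n - k) (prefixMax (values ω) k)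

variable {γ : ℝ≥0} {A : Algorithm} {Φ : ℕ → ℝ≥0 → ℝ≥0∞}

lemma measurable_potential (hΦ : ∀ s, Measurable (Φ s)) (k : ℕ) :
    Measurable (potential γ A I Φ k) :=
  Measurable.ite (A.measurable_stopTime I measurableSet_Iio)
    (measurable_reward_stopTime γ A I).coe_nnreal_ennreal
    ((hΦ _).comp ((measurable_prefixMax k).comp measurable_values))

/-- The supermartingale step. If the algorithm has stopped, observation `k` has no effect. Otherwise
stopping and continuing are both dominated by the maximum in `hstep`, so neither the past nor the
random number behind the decision matters. -/
lemma lintegral_potential_update_le (hΦ : ∀ s, Measurable (Φ s))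
    (hstep : ∀ s m, ∫⁻ x, max (max (x : ℝ≥0∞) (γ * m : ℝ≥0)) (Φ s (max m x)) ∂I.F ≤ Φ (s + 1) m)
    {k : ℕ} (hk : k < I.n) (ω : Fin I.n → Obs) :
    ∫⁻ o, potential γ A I Φ (k + 1) (Function.update ω ⟨k, hk⟩ o) ∂(I.F.prod volume)
      ≤ potential γ A I Φ k ω := by
  have hagree : ∀ o, ∀ i : Fin I.n, (i : ℕ) < k → ω i = Function.update ω ⟨k, hk⟩ o i := by
    intro o i hi
    rw [Function.update_of_ne]
    rintro rfl
    exact lt_irrefl _ hi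
  have hagree' : ∀ o, ∀ i : Fin I.n, (i : ℕ) < k →
      values (Function.update ω ⟨k, hk⟩ o) i = values ω i := fun o i hi => by
    rw [values, ← hagree o i hi, values]
  have hval : ∀ o, values (Function.update ω ⟨k, hk⟩ o) ⟨k, hk⟩ = o.1 := fun o => by
    rw [values, Function.update_self]
  by_cases hlt : A.stopTime I ω < k
  · have : ∀ o, potential γ A I Φ (k + 1) (Function.update ω ⟨k, hk⟩ o)
        = reward γ (values ω) (A.stopTime I ω) := by
      intro o
      rw [potential, A.stopTime_congr hk.le (hagree o) hlt, if_pos (by omega)]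
      congr 1
      exact reward_congr γ fun i hi => hagree' o i (by omega)
    rw [lintegral_congr this, potential, if_pos hlt]
    simp
  · have hge : ∀ o, k ≤ A.stopTime I (Function.update ω ⟨k, hk⟩ o) := fun o =>
      (A.le_stopTime_congr (hagree o) le_rfl hk.le).1 (not_lt.1 hlt)
    rw [potential, if_neg hlt]
    set m := prefixMax (values ω) k with hm
    have hpm : ∀ o, prefixMax (values (Function.update ω ⟨k, hk⟩ o)) k = m := fun o =>
      prefixMax_congr fun i hi => hagree' o i hi
    have hnk : I.n - k = (I.n - (k + 1)) + 1 := by omega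
    rw [hnk]
    refine le_trans ?_ (hstep _ m)
    have hmeas : Measurable fun x : ℝ≥0 =>
        max (max (x : ℝ≥0∞) (γ * m : ℝ≥0)) (Φ (I.n - (k + 1)) (max m x)) :=
      (measurable_coe_nnreal_ennreal.max measurable_const).max
        ((hΦ _).comp (measurable_const.max measurable_id))
    rw [← (measurePreserving_fst (μ := I.F) (ν := (volume : Measure unitInterval))).lintegral_comp
      hmeas]
    refine lintegral_mono fun o => ?_
    rw [potential]
    split_ifs with h
    · have heq : A.stopTime I (Function.update ω ⟨k, hk⟩ o) = k := by have := hge o; omega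
      rw [heq]
      refine le_max_of_le_left ?_
      have := reward_le_max_prefixMax γ (values (Function.update ω ⟨k, hk⟩ o)) hk
      rw [hval, hpm] at this
      rw [← ENNReal.coe_max]
      exact ENNReal.coe_le_coe.2 this
    · rw [prefixMax_succ _ hk, hval, hpm]
      exact le_max_right _ _

/-- A potential that dominates one step of the optimal stopping problem bounds the expected reward
of every algorithm. -/
lemma lintegral_reward_le (hΦ : ∀ s, Measurable (Φ s)) (h0 : ∀ m, ((γ * m : ℝ≥0) : ℝ≥0∞) ≤ Φ 0 m)
    (hstep : ∀ s m, ∫⁻ x, max (max (x : ℝ≥0∞) (γ * m : ℝ≥0)) (Φ s (max m x)) ∂I.F ≤ Φ (s + 1) m) :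
    ∫⁻ ω, (reward γ (values ω) (A.stopTime I ω) : ℝ≥0∞) ∂(obsLaw I) ≤ Φ I.n 0 := by
  have hind : ∀ k ≤ I.n, ∫⁻ ω, potential γ A I Φ k ω ∂(obsLaw I) ≤ Φ I.n 0 := by
    intro k
    induction k with
    | zero => simp [potential, prefixMax_zero]
    | succ k ih =>
      intro hk
      rw [lintegral_obsLaw_update ⟨k, hk⟩ (measurable_potential hΦ _)]
      exact (lintegral_mono fun ω => lintegral_potential_update_le hΦ hstep hk ω).trans
        (ih (by omega))
  refine le_trans (lintegral_mono fun ω => ?_) (hind I.n le_rfl)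
  rw [potential]
  split_ifs with h
  · exact le_rfl
  · have heq : A.stopTime I ω = I.n := le_antisymm (A.stopTime_le I ω) (not_lt.1 h)
    rw [heq, reward_last, Nat.sub_self, prefixMax_self]
    exact h0 _

lemma expectedReward_le_of_potential {c : ℝ} (hc : 0 ≤ c) (hΦ : ∀ s, Measurable (Φ s))
    (h0 : ∀ m, ((γ * m : ℝ≥0) : ℝ≥0∞) ≤ Φ 0 m)
    (hstep : ∀ s m, ∫⁻ x, max (max (x : ℝ≥0∞) (γ * m : ℝ≥0)) (Φ s (max m x)) ∂I.F ≤ Φ (s + 1) m)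
    (hn : Φ I.n 0 ≤ ENNReal.ofReal c) : expectedReward γ A I ≤ c := by
  have h := (lintegral_reward_le (A := A) hΦ h0 hstep).trans hn
  have heq : expectedReward γ A I = (∫⁻ ω, (reward γ (values ω) (A.stopTime I ω) : ℝ≥0∞)
      ∂(obsLaw I)).toReal := by
    change ∫ ω, (reward γ (values ω) (A.stopTime I ω) : ℝ) ∂(obsLaw I) = _
    rw [integral_eq_lintegral_of_nonneg_ae
      (ae_of_all _ fun ω => NNReal.zero_le_coe)
      (measurable_reward_stopTime γ A I).coe_nnreal_real.aestronglyMeasurable]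
    simp only [ENNReal.ofReal_coe_nnreal]
  rw [heq]
  exact ENNReal.toReal_le_of_le_ofReal hc h

end Potential

/-! ### Three-point distributions -/

section ThreePoint

/-- The distribution that takes the value `M` with probability `r`, and otherwise the value `1`
with probability `p` and `0` with probability `1 - p`. -/
def threePoint (M : ℝ≥0) (r p : ℝ) : Measure ℝ≥0 :=
  ENNReal.ofReal r • Measure.dirac M + ENNReal.ofReal ((1 - r) * p) • Measure.dirac 1
    + ENNReal.ofReal ((1 - r) * (1 - p)) • Measure.dirac 0

variable {M : ℝ≥0} {r p : ℝ}

lemma lintegral_threePoint (f : ℝ≥0 → ℝ≥0∞) :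
    ∫⁻ x, f x ∂(threePoint M r p) = ENNReal.ofReal r * f M + ENNReal.ofReal ((1 - r) * p) * f 1
      + ENNReal.ofReal ((1 - r) * (1 - p)) * f 0 := by
  simp [threePoint, lintegral_add_measure]

lemma isProbabilityMeasure_threePoint (hr0 : 0 ≤ r) (hr1 : r ≤ 1) (hp0 : 0 ≤ p) (hp1 : p ≤ 1) :
    IsProbabilityMeasure (threePoint M r p) := by
  constructor
  have h1 : 0 ≤ (1 - r) * p := mul_nonneg (sub_nonneg.2 hr1) hp0
  have h2 : 0 ≤ (1 - r) * (1 - p) := mul_nonneg (sub_nonneg.2 hr1) (sub_nonneg.2 hp1)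
  have := lintegral_threePoint (M := M) (r := r) (p := p) 1
  simp only [Pi.one_apply, lintegral_one, mul_one] at this
  rw [this, ← ENNReal.ofReal_add hr0 h1, ← ENNReal.ofReal_add (add_nonneg hr0 h1) h2]
  ring_nf
  simp

lemma integrable_threePoint (f : ℝ≥0 → ℝ) : Integrable f (threePoint M r p) := by
  refine ((Integrable.smul_measure ?_ ENNReal.ofReal_ne_top).add_measure
    (Integrable.smul_measure ?_ ENNReal.ofReal_ne_top)).add_measure
    (Integrable.smul_measure ?_ ENNReal.ofReal_ne_top) <;>
  exact integrable_dirac (by simp)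

lemma integral_threePoint (hr0 : 0 ≤ r) (hr1 : r ≤ 1) (hp0 : 0 ≤ p) (hp1 : p ≤ 1) (f : ℝ≥0 → ℝ) :
    ∫ x, f x ∂(threePoint M r p) = r * f M + (1 - r) * p * f 1 + (1 - r) * (1 - p) * f 0 := by
  have h1 : 0 ≤ (1 - r) * p := mul_nonneg (sub_nonneg.2 hr1) hp0
  have h2 : 0 ≤ (1 - r) * (1 - p) := mul_nonneg (sub_nonneg.2 hr1) (sub_nonneg.2 hp1)
  have hd : ∀ (c : ℝ) (x : ℝ≥0), Integrable f (ENNReal.ofReal c • Measure.dirac x) := fun c x =>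
    (integrable_dirac (by simp)).smul_measure ENNReal.ofReal_ne_top
  rw [threePoint, integral_add_measure ((hd _ _).add_measure (hd _ _)) (hd _ _),
    integral_add_measure (hd _ _) (hd _ _), integral_smul_measure, integral_smul_measure,
    integral_smul_measure, integral_dirac, integral_dirac, integral_dirac,
    ENNReal.toReal_ofReal hr0, ENNReal.toReal_ofReal h1, ENNReal.toReal_ofReal h2]
  simp only [smul_eq_mul]

/-- The instance with `n` values drawn from `threePoint M r p`. -/
def threePointInstance {n : ℕ} (hn : 0 < n) (hM : 0 < M) (hr0 : 0 < r) (hr1 : r ≤ 1) (hp0 : 0 ≤ p)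
    (hp1 : p ≤ 1) : IIDInstance where
  n := n
  n_pos := hn
  F := threePoint M r p
  isProb := isProbabilityMeasure_threePoint hr0.le hr1 hp0 hp1
  integrable := integrable_threePoint _
  mean_pos := by
    have h1 : 0 ≤ (1 - r) * p := mul_nonneg (sub_nonneg.2 hr1) hp0
    have h2 : 0 < r * M := mul_pos hr0 (by exact_mod_cast hM)
    rw [integral_threePoint hr0.le hr1 hp0 hp1]
    simp only [NNReal.coe_one, NNReal.coe_zero]
    linarith

/-- The expected maximum from the probabilities that all values are below `1`, or below `M`. -/
lemma le_expectedMax (I : IIDInstance) {M : ℝ≥0} (hM : 1 ≤ M) :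
    M * (1 - I.F.real (Set.Iio M) ^ I.n) + I.F.real (Set.Iio M) ^ I.n
      - I.F.real (Set.Iio 1) ^ I.n ≤ expectedMax I := by
  have hint : ∀ c : ℝ≥0, Integrable (fun x : Fin I.n → ℝ≥0 =>
      ∏ i, (Set.Iio c).indicator (1 : ℝ≥0 → ℝ) (x i)) (Measure.pi fun _ => I.F) := fun c =>
    Integrable.fintype_prod (f := fun _ => (Set.Iio c).indicator (1 : ℝ≥0 → ℝ)) fun _ =>
      (integrable_const (1 : ℝ)).indicator measurableSet_Iio
  have heq : ∀ c : ℝ≥0, ∫ x : Fin I.n → ℝ≥0, ∏ i, (Set.Iio c).indicator (1 : ℝ≥0 → ℝ) (x i)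
      ∂(Measure.pi fun _ => I.F) = I.F.real (Set.Iio c) ^ I.n := fun c => by
    have := integral_fintype_prod_eq_pow (ι := Fin I.n) (𝕜 := ℝ) (μ := I.F)
      ((Set.Iio c).indicator (1 : ℝ≥0 → ℝ))
    rw [this, Fintype.card_fin, integral_indicator_one measurableSet_Iio]
  have hmax : Integrable (fun x : Fin I.n → ℝ≥0 => ((Finset.univ.sup x : ℝ≥0) : ℝ))
      (Measure.pi fun _ => I.F) := by
    have h := integrable_sup_values I
    rwa [← (measurePreserving_values I).integrable_comp
      (g := fun x : Fin I.n → ℝ≥0 => ((Finset.univ.sup x : ℝ≥0) : ℝ))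
      (measurable_finset_sup_univ
        fun i => measurable_pi_apply i).coe_nnreal_real.aestronglyMeasurable]
  have h1 : Integrable (fun x : Fin I.n → ℝ≥0 =>
      (M : ℝ) * (1 - ∏ i, (Set.Iio M).indicator (1 : ℝ≥0 → ℝ) (x i)))
      (Measure.pi fun _ => I.F) := ((integrable_const (1 : ℝ)).sub (hint M)).const_mul _
  have h2 : Integrable (fun x : Fin I.n → ℝ≥0 =>
      (M : ℝ) * (1 - ∏ i, (Set.Iio M).indicator (1 : ℝ≥0 → ℝ) (x i))
      + ∏ i, (Set.Iio M).indicator (1 : ℝ≥0 → ℝ) (x i))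
      (Measure.pi fun _ => I.F) := h1.add (hint M)
  -- Pointwise, the maximum is at least `M` if some value reaches `M`, and at least `1` if none does
  -- but some value reaches `1`.
  refine le_trans (le_of_eq ?_) (integral_mono (h2.sub (hint 1)) hmax fun x => ?_)
  · simp only [Pi.sub_apply]
    rw [integral_sub h2 (hint 1), integral_add h1 (hint M), integral_const_mul,
      integral_sub (integrable_const _) (hint M), heq, heq]
    simp
  · simp only [Pi.sub_apply]
    have hprod : ∀ c : ℝ≥0, ∏ i, (Set.Iio c).indicator (1 : ℝ≥0 → ℝ) (x i)
        = if ∀ i, x i < c then 1 else 0 := by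
      intro c
      split_ifs with h
      · exact Finset.prod_eq_one fun i _ => Set.indicator_of_mem (Set.mem_Iio.2 (h i)) _
      · push Not at h
        obtain ⟨i, hi⟩ := h
        exact Finset.prod_eq_zero (Finset.mem_univ i)
          (Set.indicator_of_notMem (by simpa using hi) _)
    have hle : ∀ c : ℝ≥0, (¬ ∀ i, x i < c) → (c : ℝ) ≤ (Finset.univ.sup x : ℝ≥0) := by
      intro c h
      push Not at h
      obtain ⟨i, hi⟩ := h
      exact_mod_cast hi.trans (Finset.le_sup (f := x) (Finset.mem_univ i))
    rw [hprod, hprod]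
    by_cases h1 : ∀ i, x i < 1
    · rw [if_pos h1, if_pos fun i => (h1 i).trans_le hM]
      simp
    · rw [if_neg h1]
      have e1 := hle 1 h1
      rw [NNReal.coe_one] at e1
      split_ifs with h2
      · simpa using e1
      · simpa using hle M h2

lemma le_expectedMax_threePointInstance {n : ℕ} (hn : 0 < n) (hM : 1 < M) (hr0 : 0 < r)
    (hr1 : r ≤ 1) (hp0 : 0 ≤ p) (hp1 : p ≤ 1) :
    M * (1 - (1 - r) ^ n) + (1 - r) ^ n * (1 - (1 - p) ^ n)
      ≤ expectedMax (threePointInstance hn (zero_lt_one.trans hM) hr0 hr1 hp0 hp1) := by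
  refine le_trans (le_of_eq ?_) (le_expectedMax _ hM.le)
  have hF : ∀ c : ℝ≥0, (threePoint M r p).real (Set.Iio c)
      = ∫ x, (Set.Iio c).indicator 1 x ∂(threePoint M r p) := fun c =>
    (integral_indicator_one measurableSet_Iio).symm
  change _ = M * (1 - (threePoint M r p).real (Set.Iio M) ^ n)
    + (threePoint M r p).real (Set.Iio M) ^ n - (threePoint M r p).real (Set.Iio 1) ^ n
  have hM0 : 0 < M := zero_lt_one.trans hM
  rw [hF, hF, integral_threePoint hr0.le hr1 hp0 hp1, integral_threePoint hr0.le hr1 hp0 hp1]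
  simp only [Set.indicator, Set.mem_Iio, lt_irrefl, if_false, hM, hM0, if_true, Pi.one_apply,
    zero_lt_one, hM.not_gt]
  have e : r * 0 + (1 - r) * p * 1 + (1 - r) * (1 - p) * 1 = 1 - r := by ring
  have e' : r * 0 + (1 - r) * p * 0 + (1 - r) * (1 - p) * 1 = (1 - r) * (1 - p) := by ring
  rw [e, e', mul_pow]
  ring

/-- Functions `V` and `W` that bound the value of the remaining steps, when the largest value so
far is `0` or `1`, bound the expected reward on a three-point distribution. -/
lemma expectedReward_threePointInstance_le {n : ℕ} (hn : 0 < n) (hM : 1 < M) (hr0 : 0 < r)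
    (hr1 : r ≤ 1) (hp0 : 0 ≤ p) (hp1 : p ≤ 1) {γ : ℝ≥0} (hγ : γ ≤ 1) (A : Algorithm)
    {V W : ℕ → ℝ} (hV : ∀ s, 0 ≤ V s) (hW : ∀ s, γ ≤ W s)
    (hVstep : ∀ s, r * M + (1 - r) * p * max 1 (W s) + (1 - r) * (1 - p) * V s ≤ V (s + 1))
    (hWstep : ∀ s, r * M + (1 - r) * p * max 1 (W s) + (1 - r) * (1 - p) * W s ≤ W (s + 1)) :
    expectedReward γ A (threePointInstance hn (zero_lt_one.trans hM) hr0 hr1 hp0 hp1) ≤ V n := by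
  have hM0 : 0 < M := zero_lt_one.trans hM
  have hc1 : 0 ≤ (1 - r) * p := mul_nonneg (sub_nonneg.2 hr1) hp0
  have hc2 : 0 ≤ (1 - r) * (1 - p) := mul_nonneg (sub_nonneg.2 hr1) (sub_nonneg.2 hp1)
  have hγM : γ * M ≤ M := mul_le_of_le_one_left' hγ
  -- Once `M` has appeared, `M` bounds every later reward. Off the support the value `⊤` makes the
  -- step inequality trivial, since it is demanded for all `m`.
  set Φ : ℕ → ℝ≥0 → ℝ≥0∞ := fun s m => if m = 0 then ENNReal.ofReal (V s)
    else if m = 1 then ENNReal.ofReal (W s) else if m = M then M else ⊤ with hΦ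
  have Φ0 : ∀ s, Φ s 0 = ENNReal.ofReal (V s) := fun s => if_pos rfl
  have Φ1 : ∀ s, Φ s 1 = ENNReal.ofReal (W s) := fun s => by simp [hΦ]
  have ΦM : ∀ s, Φ s M = M := fun s => by simp [hΦ, hM0.ne', hM.ne']
  have hγW : ∀ s, (γ : ℝ≥0∞) ≤ ENNReal.ofReal (W s) := fun s => by
    rw [← ENNReal.ofReal_coe_nnreal]
    exact ENNReal.ofReal_le_ofReal (hW s)
  have hmaxW : ∀ s, max 1 (ENNReal.ofReal (W s)) = ENNReal.ofReal (max 1 (W s)) := fun s => by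
    rw [ENNReal.ofReal_max, ENNReal.ofReal_one]
  have hstep_real : ∀ {w v v' : ℝ}, 0 ≤ w → 0 ≤ v →
      r * M + (1 - r) * p * w + (1 - r) * (1 - p) * v ≤ v' →
      ENNReal.ofReal r * M + ENNReal.ofReal ((1 - r) * p) * ENNReal.ofReal w
        + ENNReal.ofReal ((1 - r) * (1 - p)) * ENNReal.ofReal v ≤ ENNReal.ofReal v' := by
    intro w v v' hw hv h
    rw [← ENNReal.ofReal_coe_nnreal (p := M), ← ENNReal.ofReal_mul hr0.le,
      ← ENNReal.ofReal_mul hc1, ← ENNReal.ofReal_mul hc2, ← ENNReal.ofReal_add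
      (mul_nonneg hr0.le NNReal.zero_le_coe) (mul_nonneg hc1 hw), ← ENNReal.ofReal_add
      (add_nonneg (mul_nonneg hr0.le NNReal.zero_le_coe) (mul_nonneg hc1 hw)) (mul_nonneg hc2 hv)]
    exact ENNReal.ofReal_le_ofReal h
  refine expectedReward_le_of_potential (Φ := Φ) (hV n) (fun s => ?_) (fun m => ?_)
    (fun s m => ?_) (Φ0 n).le
  · exact Measurable.ite (measurableSet_singleton _) measurable_const
      (Measurable.ite (measurableSet_singleton _) measurable_const
        (Measurable.ite (measurableSet_singleton _) measurable_const measurable_const))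
  · by_cases m0 : m = 0
    · simp [m0]
    by_cases m1 : m = 1
    · rw [m1, Φ1, mul_one]
      exact hγW 0
    by_cases mM : m = M
    · rw [mM, ΦM]
      exact_mod_cast hγM
    · simp [hΦ, m0, m1, mM]
  · change ∫⁻ x, _ ∂(threePoint M r p) ≤ _
    rw [lintegral_threePoint]
    by_cases m0 : m = 0
    · subst m0
      simp only [mul_zero, ENNReal.coe_zero, ENNReal.coe_one, zero_le, max_eq_left, max_eq_right,
        Φ0, Φ1, ΦM, max_self, hmaxW]
      exact hstep_real (le_max_of_le_left zero_le_one) (hV s) (hVstep s)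
    by_cases m1 : m = 1
    · subst m1
      have e1 : max (M : ℝ≥0∞) γ = M :=
        max_eq_left (ENNReal.coe_le_coe.2 (hγ.trans hM.le))
      have e2 : max (1 : ℝ≥0∞) γ = 1 := max_eq_left (by exact_mod_cast hγ)
      have e3 : max (0 : ℝ≥0∞) γ = γ := max_eq_right zero_le
      have e4 : max (1 : ℝ≥0) 0 = 1 := max_eq_left zero_le
      simp only [mul_one, ENNReal.coe_zero, ENNReal.coe_one, max_eq_right hM.le, max_self,
        Φ1, ΦM, e1, e2, e3, e4, max_eq_right (hγW s), hmaxW]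
      exact hstep_real (le_max_of_le_left zero_le_one) (NNReal.zero_le_coe.trans (hW s)) (hWstep s)
    by_cases mM : m = M
    · subst mM
      have e0 : ∀ x : ℝ≥0, x ≤ m → max (max (x : ℝ≥0∞) (γ * m : ℝ≥0)) m = m := fun x hx =>
        max_eq_right (max_le (by exact_mod_cast hx) (by exact_mod_cast hγM))
      rw [max_self, max_eq_left hM.le, max_eq_left (zero_le : 0 ≤ m), ΦM, ΦM,
        e0 m le_rfl, e0 1 hM.le, e0 0 zero_le, ← add_mul, ← add_mul,
        ← ENNReal.ofReal_add hr0.le hc1, ← ENNReal.ofReal_add (add_nonneg hr0.le hc1) hc2]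
      have : r + (1 - r) * p + (1 - r) * (1 - p) = 1 := by ring
      rw [this, ENNReal.ofReal_one, one_mul]
    · simp [hΦ, m0, m1, mM]

end ThreePoint

/-! ### The hard instances and their limit -/

section UpperBound

/-- The solution of `g' = 2 (1 - min g 0)` with `g 0 = 0`: exponential before `0`, linear after. -/
def excess (u : ℝ) : ℝ := if u ≤ 0 then 1 - Real.exp (-2 * u) else 2 * u

lemma one_sub_exp_le_two_mul (u : ℝ) : 1 - Real.exp (-2 * u) ≤ 2 * u := by
  linarith [Real.add_one_le_exp (-2 * u)]

lemma one_sub_exp_le_excess (u : ℝ) : 1 - Real.exp (-2 * u) ≤ excess u := by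
  unfold excess
  split_ifs
  · exact le_rfl
  · exact one_sub_exp_le_two_mul u

/-- From `u ≤ 0` the step is exact along the exponential curve, which stays below `excess`; from `u
> 0` it reduces to `1 - exp(-2h) ≤ 2h`. -/
lemma excess_step {u h : ℝ} (hh : 0 ≤ h) :
    (1 - Real.exp (-2 * h)) + (1 - Real.exp (-2 * h)) * max 0 (excess u)
      + Real.exp (-2 * h) * excess u ≤ excess (u + h) := by
  rcases le_or_gt u 0 with hu | hu
  · have hle : excess u ≤ 0 := by
      rw [excess, if_pos hu, sub_nonpos]
      exact Real.one_le_exp (by linarith)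
    rw [max_eq_left hle]
    refine le_trans (le_of_eq ?_) (one_sub_exp_le_excess (u + h))
    rw [excess, if_pos hu, mul_add, Real.exp_add]
    ring
  · have he : excess u = 2 * u := if_neg hu.not_ge
    have he' : excess (u + h) = 2 * (u + h) := if_neg (by linarith)
    rw [he', he, max_eq_right (by linarith)]
    linarith [one_sub_exp_le_two_mul h]

/-- The expected total of the large values in the hard instances. -/
def largeMass (γ : ℝ) : ℝ := 2 * (1 - γ) / (2 - γ)

/-- The value of the remaining time `t` in the limit of the hard instances, after a value `1` has
been passed. -/
def passedValue (γ t : ℝ) : ℝ := 1 + largeMass γ / 2 * excess (t - Real.log (3 - γ) / 2)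

variable {γ : ℝ}

lemma largeMass_pos (h : γ < 1) : 0 < largeMass γ :=
  div_pos (by linarith) (by linarith)

lemma largeMass_half_mul (h : γ < 1) : largeMass γ / 2 * (2 - γ) = 1 - γ := by
  have : 2 - γ ≠ 0 := by linarith
  unfold largeMass
  field_simp

/-- The shift `log (3 - γ) / 2` is chosen so that the excess at `t = 0` is `-(2 - γ)`, which
`largeMass` converts into the initial value `γ`. -/
lemma passedValue_ge (h : γ < 1) {t : ℝ} (ht : 0 ≤ t) : γ ≤ passedValue γ t := by
  have hex : -(2 - γ) ≤ excess (t - Real.log (3 - γ) / 2) := by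
    refine le_trans ?_ (one_sub_exp_le_excess _)
    have : Real.exp (-2 * (t - Real.log (3 - γ) / 2)) ≤ Real.exp (Real.log (3 - γ)) :=
      Real.exp_le_exp.2 (by linarith)
    rw [Real.exp_log (by linarith)] at this
    linarith
  have := mul_le_mul_of_nonneg_left hex (half_pos (largeMass_pos h)).le
  unfold passedValue
  linarith [largeMass_half_mul h]

lemma passedValue_step (h : γ < 1) {t d : ℝ} (hd : 0 ≤ d) :
    largeMass γ / 2 * (1 - Real.exp (-2 * d))
      + (1 - Real.exp (-2 * d)) * max 1 (passedValue γ t) + Real.exp (-2 * d) * passedValue γ t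
      ≤ passedValue γ (t + d) := by
  have ha := (half_pos (largeMass_pos h)).le
  have hs := mul_le_mul_of_nonneg_left (excess_step (u := t - Real.log (3 - γ) / 2) hd) ha
  have hm : max 1 (passedValue γ t)
      = 1 + largeMass γ / 2 * max 0 (excess (t - Real.log (3 - γ) / 2)) := by
    rw [mul_max_of_nonneg _ _ ha, mul_zero, ← max_add_add_left, add_zero, passedValue]
  rw [hm]
  have : t + d - Real.log (3 - γ) / 2 = t - Real.log (3 - γ) / 2 + d := by ring
  unfold passedValue
  rw [this]
  linarith

lemma U_eq_div (h0 : 0 ≤ γ) (h : γ < 1) :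
    U γ = (passedValue γ 1 - γ * Real.exp (-2)) / (largeMass γ + (1 - Real.exp (-2))) := by
  have hl : Real.log (3 - γ) < 2 :=
    (Real.log_le_log (by linarith) (by linarith : 3 - γ ≤ 3)).trans_lt
      (by linarith [Real.log_three_lt_d9])
  have hE := seven_lt_exp_two
  have hexp : Real.exp (-2) = (Real.exp 1 ^ 2)⁻¹ := by
    rw [Real.exp_neg, ← Real.exp_nat_mul]
    norm_num
  have hD := U_denominator_pos h.le
  have hg : 0 < 2 - γ := by linarith
  -- Since `log (3 - γ) < 2`, time `1` lies in the linear branch.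
  rw [passedValue, excess, if_neg (by linarith), U, hexp, largeMass]
  generalize Real.exp 1 ^ 2 = E at hE hD
  generalize Real.log (3 - γ) = l
  have hE0 : E ≠ 0 := by linarith
  have hB : 2 * (1 - γ) / (2 - γ) + (1 - E⁻¹)
      = (2 * (2 * E - 1) - (3 * E - 1) * γ) / (E * (2 - γ)) := by
    field_simp
    ring
  rw [hB, eq_div_iff (div_pos hD (by positivity)).ne', sub_mul, div_mul_div_comm, one_mul]
  have hD' := hD.ne'
  rw [mul_comm (2 * (2 * E - 1) - (3 * E - 1) * γ) (E * (2 - γ)), ← div_mul_div_comm,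
    div_self hD', mul_one]
  field_simp
  ring

/-- The hard instances. -/
lemma competitiveRatio_le_div {γ : ℝ≥0} (h : γ < 1) (A : Algorithm) {n : ℕ}
    (hn : 3 / largeMass γ < n) :
    competitiveRatio γ A ≤ (passedValue γ 1 - γ * Real.exp (-2)) /
      (largeMass γ * (n / (n + 2)) * (n / (n + 1)) + (1 - 1 / n) * (1 - Real.exp (-2))) := by
  have hγ : (γ : ℝ) < 1 := by exact_mod_cast h
  have ha := largeMass_pos hγ
  have hn0 : (0 : ℝ) < n := (div_pos three_pos ha).trans hn
  have hn1 : (1 : ℝ) ≤ n := by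
    have : 0 < n := by exact_mod_cast hn0
    exact_mod_cast this
  have hnpos : 0 < n := by exact_mod_cast hn0
  set d : ℝ := 1 / n with hd
  have hd0 : 0 < d := by positivity
  have hnd : n * d = 1 := by rw [hd]; field_simp
  set p : ℝ := 1 - Real.exp (-2 * d) with hp
  have hp1 : p ≤ 1 := sub_le_self _ (Real.exp_pos _).le
  have hp0 : 2 / (n + 2) ≤ p := by
    have h1 : 1 + 2 * d ≤ Real.exp (2 * d) := by linarith [Real.add_one_le_exp (2 * d)]
    have h2 : Real.exp (-2 * d) ≤ (1 + 2 * d)⁻¹ := by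
      rw [neg_mul, Real.exp_neg]
      exact inv_anti₀ (by positivity) h1
    have h3 : (1 + 2 * d)⁻¹ = 1 - 2 / (n + 2) := by
      rw [hd]; field_simp; ring
    linarith
  have hppos : 0 < p := lt_of_lt_of_le (by positivity) hp0
  set r : ℝ := 1 / n ^ 2 with hr
  have hr0 : 0 < r := by positivity
  have hr1 : r ≤ 1 := by
    rw [hr, div_le_one (by positivity)]
    nlinarith
  have hMnn : 0 ≤ largeMass γ / 2 * p * (n : ℝ) ^ 2 := by positivity
  -- Chosen to make `r M = (largeMass γ / 2) p` exactly, the source term in `passedValue_step`.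
  set M : ℝ≥0 := ⟨largeMass γ / 2 * p * (n : ℝ) ^ 2, hMnn⟩ with hMdef
  have hMcoe : (M : ℝ) = largeMass γ / 2 * p * (n : ℝ) ^ 2 := rfl
  have hMge : largeMass γ * (n / (n + 2)) * n ≤ M := by
    have : largeMass γ * (n / (n + 2)) * n = largeMass γ / 2 * (2 / (n + 2)) * (n : ℝ) ^ 2 := by
      field_simp
    rw [hMcoe, this]
    gcongr
  have hM : 1 < M := by
    have h1 : (1 : ℝ) / 3 ≤ n / (n + 2) := by
      rw [div_le_div_iff₀ (by norm_num) (by linarith)]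
      linarith
    have h2 : 3 < largeMass γ * n := by rwa [div_lt_iff₀ ha, mul_comm] at hn
    have h3 : (1 : ℝ) < M := by
      refine lt_of_lt_of_le ?_ hMge
      nlinarith
    exact_mod_cast h3
  have hrM : r * M = largeMass γ / 2 * p := by rw [hMcoe, hr]; field_simp
  have hone : 1 - p = Real.exp (-2 * d) := by rw [hp]; ring
  have hW : ∀ s : ℕ, (γ : ℝ) ≤ passedValue γ (s * d) := fun s => passedValue_ge hγ (by positivity)
  have hexpd : ∀ s : ℕ, Real.exp (-2 * (s * d)) ≤ 1 := fun s =>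
    Real.exp_le_one_iff.2 (by nlinarith [mul_nonneg (Nat.cast_nonneg (α := ℝ) s) hd0.le])
  have hγ0 : (0 : ℝ) ≤ γ := NNReal.zero_le_coe
  have hV : ∀ s : ℕ, 0 ≤ passedValue γ (s * d) - γ * Real.exp (-2 * (s * d)) := fun s => by
    nlinarith [hW s, hexpd s]
  have hstep : ∀ s : ℕ, largeMass γ / 2 * p + p * max 1 (passedValue γ (s * d))
      + (1 - p) * passedValue γ (s * d) ≤ passedValue γ ((s + 1 : ℕ) * d) := fun s => by
    have := passedValue_step hγ (t := s * d) hd0.le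
    rw [hone]
    push_cast
    rwa [add_one_mul]
  -- The factor `1 - r` may be dropped, as this only enlarges the nonnegative value of the remaining
  -- steps.
  have hshrink : ∀ {w v : ℝ}, 0 ≤ w → 0 ≤ v →
      (1 - r) * p * w + (1 - r) * (1 - p) * v ≤ p * w + (1 - p) * v := fun {w v} hw hv => by
    have := mul_nonneg hr0.le (add_nonneg (mul_nonneg hppos.le hw)
      (mul_nonneg (sub_nonneg.2 hp1) hv))
    nlinarith
  have hreward := expectedReward_threePointInstance_le hnpos hM hr0 hr1 hppos.le hp1 h.le A
    (V := fun s : ℕ => passedValue γ (s * d) - γ * Real.exp (-2 * (s * d)))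
    (W := fun s : ℕ => passedValue γ (s * d)) hV hW
    (fun s => by
      have h1 := hshrink (w := max 1 (passedValue γ (s * d))) (by positivity) (hV s)
      -- The gap `γ exp(-2t)` between `W` and `V` shrinks by `1 - p` per step: it survives only
      -- while no one arrives.
      have h2 : Real.exp (-2 * ((s + 1 : ℕ) * d)) = (1 - p) * Real.exp (-2 * (s * d)) := by
        rw [hone, ← Real.exp_add]
        push_cast
        ring_nf
      have := hstep s
      simp only [h2]
      rw [hrM]
      nlinarith)
    (fun s => by
      have h1 := hshrink (w := max 1 (passedValue γ (s * d))) (by positivity)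
        (NNReal.zero_le_coe.trans (hW s))
      have := hstep s
      rw [hrM]
      linarith)
  simp only [hnd, mul_one] at hreward
  refine (competitiveRatio_le _ γ A).trans (div_le_div₀ ?_ hreward ?_ ?_)
  · have := hV n
    rwa [hnd, mul_one] at this
  · have h1 : Real.exp (-2) < 1 := (Real.exp_lt_one_iff).2 (by norm_num)
    have h2 : 0 ≤ (1 - 1 / (n : ℝ)) * (1 - Real.exp (-2)) :=
      mul_nonneg (sub_nonneg.2 (by rw [div_le_one hn0]; exact hn1)) (by linarith)
    positivity
  · refine le_trans ?_ (le_expectedMax_threePointInstance hnpos hM hr0 hr1 hppos.le hp1)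
    have hpn : (1 - p) ^ n = Real.exp (-2) := by
      rw [hone, ← Real.exp_nat_mul]
      congr 1
      linear_combination (-2 : ℝ) * hnd
    have hnr : n * r = 1 / n := by rw [hr]; field_simp
    have hlow : 1 - 1 / (n : ℝ) ≤ (1 - r) ^ n := by
      have := one_add_mul_le_pow (a := -r) (by linarith) n
      rw [← sub_eq_add_neg] at this
      linarith
    -- From `(1-r)(1+r) ≤ 1` and Bernoulli's inequality for `1 + r`, `(1-r)^n ≤ 1 / (1 + 1/n)`.
    have hup : (n : ℝ)⁻¹ * (n / (n + 1)) ≤ 1 - (1 - r) ^ n := by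
      have h1 := one_add_mul_le_pow (a := r) (by linarith) n
      have h2 : (1 - r) ^ n * (1 + r) ^ n ≤ 1 := by
        rw [← mul_pow]
        exact pow_le_one₀ (mul_nonneg (by linarith) (by linarith)) (by nlinarith)
      have h3 : (1 - r) ^ n * (1 + 1 / n) ≤ 1 := by
        rw [← hnr]
        exact (mul_le_mul_of_nonneg_left h1 (pow_nonneg (by linarith) n)).trans h2
      have h4 : (1 - r) ^ n ≤ 1 / (1 + 1 / n) := by rwa [le_div_iff₀ (by positivity)]
      have h5 : (n : ℝ)⁻¹ * (n / (n + 1)) = 1 - 1 / (1 + 1 / (n : ℝ)) := by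
        field_simp
        ring
      linarith
    rw [hpn]
    have h1 : Real.exp (-2) < 1 := (Real.exp_lt_one_iff).2 (by norm_num)
    refine add_le_add ?_ (mul_le_mul_of_nonneg_right hlow (by linarith))
    have : largeMass γ * (n / (n + 2)) * (n / (n + 1))
        = largeMass γ * (n / (n + 2)) * n * ((n : ℝ)⁻¹ * (n / (n + 1))) := by
      field_simp
    rw [this]
    exact mul_le_mul hMge hup (by positivity) NNReal.zero_le_coe

theorem competitiveRatio_le_U {γ : ℝ≥0} (hγ : γ ≤ 1) (A : Algorithm) :
    competitiveRatio γ A ≤ U γ := by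
  rcases hγ.eq_or_lt with rfl | h
  · rw [NNReal.coe_one, U_one]
    obtain ⟨I⟩ := (inferInstance : Nonempty IIDInstance)
    exact (competitiveRatio_le I 1 A).trans
      (div_le_one_of_le₀ (expectedReward_le_expectedMax I le_rfl A) (expectedMax_pos I).le)
  · have hγ' : (γ : ℝ) < 1 := by exact_mod_cast h
    rw [U_eq_div NNReal.zero_le_coe hγ']
    have h1 : Real.exp (-2) < 1 := (Real.exp_lt_one_iff).2 (by norm_num)
    have hB : largeMass γ * 1 * 1 + (1 - 0) * (1 - Real.exp (-2)) ≠ 0 := by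
      have := largeMass_pos hγ'
      linarith
    have hlim : Filter.Tendsto (fun n : ℕ => (passedValue γ 1 - γ * Real.exp (-2)) /
        (largeMass γ * ((n : ℝ) / (n + 2)) * (n / (n + 1))
          + (1 - 1 / n) * (1 - Real.exp (-2)))) Filter.atTop
        (nhds ((passedValue γ 1 - γ * Real.exp (-2)) /
          (largeMass γ * 1 * 1 + (1 - 0) * (1 - Real.exp (-2))))) :=
      Filter.Tendsto.div tendsto_const_nhds
        (((tendsto_const_nhds.mul (tendsto_natCast_div_add_atTop (2 : ℝ))).mul
          (tendsto_natCast_div_add_atTop (1 : ℝ))).add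
          ((tendsto_const_nhds.sub tendsto_one_div_atTop_nhds_zero_nat).mul tendsto_const_nhds)) hB
    have hlim' := ge_of_tendsto hlim ((Filter.eventually_gt_atTop _).natCast_atTop.mono
      fun n hn => competitiveRatio_le_div h A hn)
    simpa using hlim'

end UpperBound

end Prophet

end

theorem theorem4 :
    -- every algorithm has competitive ratio at most `U γ`
    (∀ γ : ℝ≥0, γ ≤ 1 → ∀ A : Prophet.Algorithm,
      Prophet.competitiveRatio γ A ≤ Prophet.U γ) ∧
    -- properties of `U`
    StrictMonoOn Prophet.U (Set.Icc 0 1) ∧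
    Prophet.U 0 = (4 - Real.log 3) / (2 * (2 - 1 / Real.exp 1 ^ 2)) ∧
    |Prophet.U 0 - 0.778| < 0.0005 ∧
    Prophet.U 1 = 1 ∧
    -- `p_γ` is well defined, and some single-threshold algorithm is `1 - (1 - γ) p_γ`-competitive;
    -- it randomizes only if the distribution has atoms
    (∀ γ : ℝ≥0, γ ≤ 1 →
      (∃! p : ℝ, Prophet.IsSolution γ p) ∧
      ∀ p : ℝ, Prophet.IsSolution γ p →
        ∃ (θ : Prophet.IIDInstance → ℝ≥0∞) (q : Prophet.IIDInstance → unitInterval),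
          (∀ I : Prophet.IIDInstance, (∀ x : ℝ≥0, I.F {x} = 0) → q I = 0) ∧
          1 - (1 - (γ : ℝ)) * p ≤ Prophet.competitiveRatio γ (Prophet.singleThreshold θ q)) :=
  ⟨fun _ hγ A => Prophet.competitiveRatio_le_U hγ A, Prophet.U_strictMonoOn, Prophet.U_zero,
    Prophet.abs_U_zero_sub_lt, Prophet.U_one, fun γ hγ =>
    ⟨(Prophet.exists_isSolution γ.coe_nonneg (by exact_mod_cast hγ)).imp fun _ hp =>
      ⟨hp, fun _ hp' => hp'.unique (by exact_mod_cast hγ) hp⟩,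
    fun _ hp => Prophet.exists_singleThreshold_ge hγ hp⟩⟩
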